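/- A language $L\subseteq\Sigma^*$ over a finite alphabet $\Sigma$ is called decomposable if $L=L_1L_2$ for some languages $L_1,L_2\subseteq\Sigma^*$ with $L_1\neq\{\varepsilon\}\neq L_2$, and prime otherwise. A deterministic finite automaton (DFA) here has one initial state and a (possibly partial) transition function $Q\times\Sigma\rightharpoonup Q$; its transition table is written out as a bit string in a standard way. Let $\mathrm{Primality_{finite}}$ be the set of all bit strings that encode a DFA $M$ (over an arbitrary finite alphabet, which is part of the input) whose language $L(M)$ is finite and prime, and let $\neg\mathrm{Primality_{finite}}$ be the set of all bit strings that encode a DFA $M$ whose language $L(M)$ is finite and decomposable. Let $\Sigma_2^{\mathrm P}$ be the class of all $A\subseteq\{0,1\}^*$ for which there are a polynomial $p$ and a ternary relation $R$ on $\{0,1\}^*$, decidable by a deterministic Turing machine in polynomial time, such that for all $x$ $$x\in A\iff\exists y\,(|y|\le p(|x|))\ \forall z\,(|z|\le p(|x|)):\ (x,y,z)\in R,$$ and let $\Pi_2^{\mathrm P}$ be the class of all complements $\{0,1\}^*\setminus A$ with $A\in\Sigma_2^{\mathrm P}$. Proposition. $\mathrm{Primality_{finite}}$ is in $\Pi_2^{\mathrm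 P}$, and $\neg\mathrm{Primality_{finite}}$ is in $\Sigma_2^{\mathrm P}$. -/

import Mathlib

open Turing Computability

/-! ### Prime languages -/

/-- `L` is decomposable: it is a product `L₁ L₂` of two languages, both different from `{ε}`
(in Mathlib, `1 : Language α` is `{ε}` and `*` is concatenation). -/
def Language.IsDecomposable {α : Type*} (L : Language α) : Prop :=
  ∃ L₁ L₂ : Language α, L₁ ≠ 1 ∧ L₂ ≠ 1 ∧ L = L₁ * L₂

/-- `L` is prime: it is not decomposable. -/
def Language.IsPrimeLanguage {α : Type*} (L : Language α) : Prop :=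
  ¬ L.IsDecomposable

/-! ### Deterministic finite automata with a partial transition function -/

/-- A deterministic finite automaton with state set `{0, …, states - 1}` and alphabet
`{0, …, letters - 1}`. The transition function is partial: `none` means that there is no
transition. -/
structure PartialDFA where
  states : ℕ
  letters : ℕ
  step : Fin states → Fin letters → Option (Fin states)
  start : Fin states
  accept : Finset (Fin states)

namespace PartialDFA

/-- The automaton as an NFA with one initial state and at most one successor for each state and
letter. -/
def toNFA (M : PartialDFA) : NFA (Fin M.letters) (Fin M.states) where
  step q a := {q' | M.step q a = some q'}
  start := {M.start}
  accept := {q | q ∈ M.accept}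

/-- The language `L(M)`. -/
def language (M : PartialDFA) : Language (Fin M.letters) :=
  M.toNFA.accepts

/-- The row of the state `q` in the description of `M`: whether `q` is accepting (`1` or `0`),
then for each letter `a` the number `0` if there is no transition and `q' + 1` if there is a
transition to `q'`. -/
def row (M : PartialDFA) (q : Fin M.states) : List ℕ :=
  (if q ∈ M.accept then 1 else 0) ::
    List.ofFn fun a => (M.step q a).elim 0 fun q' => (q' : ℕ) + 1

/-- The description of `M` as a list of numbers: the number of states, the number of letters, the
start state, and the rows of all states. -/
def description (M : PartialDFA) : List ℕ :=
  M.states :: M.letters :: (M.start : ℕ) :: (List.ofFn M.row).flatten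

/-- The input string for `M`: its description, each number `m` being written as `1ᵐ0`.
As the transition table is written out entry by entry and its entries are at most the number of
states, the length is polynomially related to that of a description with binary numbers. -/
def encode (M : PartialDFA) : List Bool :=
  M.description.flatMap fun m => List.replicate m true ++ [false]

end PartialDFA

/-- A list of numbers can be read off from its unary code. -/
theorem unaryList_injective : Function.Injective
    (fun l : List ℕ => l.flatMap fun m => List.replicate m true ++ [false]) := by
  have key : ∀ (m m' : ℕ) (s t : List Bool),
      List.replicate m true ++ false :: s = List.replicate m' true ++ false :: t →
        m = m' ∧ s = t := by
    intro m
    induction m with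
    | zero => intro m' s t h; cases m' <;> simp_all [List.replicate_succ]
    | succ m ih =>
      intro m' s t h
      cases m' with
      | zero => simp [List.replicate_succ] at h
      | succ m' =>
        simp only [List.replicate_succ, List.cons_append, List.cons.injEq, true_and] at h
        obtain ⟨h1, h2⟩ := ih m' s t h
        exact ⟨by rw [h1], h2⟩
  intro l
  induction l with
  | nil => intro l' h; cases l' <;> simp_all
  | cons a l ih =>
    intro l' h
    cases l' with
    | nil => simp at h
    | cons b l' =>
      simp only [List.flatMap_cons, List.append_assoc, List.singleton_append] at h
      obtain ⟨h1, h2⟩ := key _ _ _ _ h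
      rw [h1, ih h2]

/-- An automaton is determined by its input string. -/
theorem PartialDFA.encode_injective : Function.Injective PartialDFA.encode := by
  have flat : ∀ {n k : ℕ} (f g : Fin n → List ℕ), (∀ i, (f i).length = k) →
      (∀ i, (g i).length = k) → (List.ofFn f).flatten = (List.ofFn g).flatten → f = g := by
    intro n k
    induction n with
    | zero => intro f g _ _ _; funext i; exact i.elim0
    | succ n ih =>
      intro f g hf hg h
      simp only [List.ofFn_succ, List.flatten_cons] at h
      obtain ⟨h0, h1⟩ := List.append_inj h (by rw [hf, hg])
      have := ih _ _ (fun i => hf i.succ) (fun i => hg i.succ) h1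
      funext i
      refine Fin.cases h0 (fun j => congrFun this j) i
  intro M M' h
  have hd : M.description = M'.description := unaryList_injective h
  obtain ⟨n, k, δ, s, F⟩ := M
  obtain ⟨n', k', δ', s', F'⟩ := M'
  simp only [description, List.cons.injEq] at hd
  obtain ⟨h1, h2, h3, h4⟩ := hd
  subst h1 h2
  have hr := flat (k := k + 1) _ _ (fun i => by simp [row]) (fun i => by simp [row]) h4
  have hs : s = s' := Fin.ext h3
  have hrow : ∀ q, (if q ∈ F then 1 else 0) = (if q ∈ F' then 1 else 0) ∧
      (fun a => (δ q a).elim 0 fun q' => (q' : ℕ) + 1) =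
        fun a => (δ' q a).elim 0 fun q' => (q' : ℕ) + 1 := by
    intro q
    have := congrFun hr q
    simp only [row, List.cons.injEq, List.ofFn_inj] at this
    exact this
  have hF : F = F' := by
    ext q
    have := (hrow q).1
    by_cases a : q ∈ F <;> by_cases b : q ∈ F' <;> simp_all
  have hδ : δ = δ' := by
    funext q a
    have := congrFun (hrow q).2 a
    rcases e : δ q a with _ | u <;> rcases e' : δ' q a with _ | v <;>
      simp only [e, e', Option.elim] at this
    · rfl
    · omega
    · omega
    · exact congrArg some (Fin.ext (by omega))
  subst hs hF hδ
  rfl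

/-! ### The decision problems -/

/-- `Primality_finite`: the strings that encode a deterministic finite automaton with a finite
prime language. -/
def PrimalityFinite : Language Bool :=
  {x | ∃ M : PartialDFA, M.encode = x ∧ Set.Finite (M.language : Set (List (Fin M.letters))) ∧
    M.language.IsPrimeLanguage}

/-- `¬ Primality_finite`, the problem with the same instances and negated answer: the strings that
encode a deterministic finite automaton with a finite decomposable language. -/
def NonPrimalityFinite : Language Bool :=
  {x | ∃ M : PartialDFA, M.encode = x ∧ Set.Finite (M.language : Set (List (Fin M.letters))) ∧
    ¬ M.language.IsPrimeLanguage}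

/-! ### The second level of the polynomial hierarchy -/

/-- The encoding of triples of bit strings over a finite alphabet, with a different copy of
`Bool` for each component. -/
def tripleEncoding :
    Encoding (List Bool × List Bool × List Bool) (Bool ⊕ Bool ⊕ Bool) :=
  encodingProd (encodingList Bool) (encodingProd (encodingList Bool) (encodingList Bool))

/-- A ternary relation on bit strings is decidable in polynomial time by a Turing machine (time
measured in the total length of the three strings). -/
def PolyTimeDecidable (R : List Bool × List Bool × List Bool → Bool) : Prop :=
  Nonempty (TM2ComputableInPolyTime tripleEncoding.encode encodeBool R)

/-- The class `Σ₂ᴾ`: there are a polynomial `p` and a polynomial-time decidable relation `R` such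
that `x ∈ A` iff there is `y` with `|y| ≤ p(|x|)` such that for all `z` with `|z| ≤ p(|x|)` the
relation `R(x, y, z)` holds. -/
def InSigma2P (A : Language Bool) : Prop :=
  ∃ (p : Polynomial ℕ) (R : List Bool × List Bool × List Bool → Bool),
    PolyTimeDecidable R ∧
      ∀ x : List Bool, x ∈ A ↔
        ∃ y : List Bool, y.length ≤ p.eval x.length ∧
          ∀ z : List Bool, z.length ≤ p.eval x.length → R (x, y, z) = true

/-- The class `Π₂ᴾ` of the complements of the languages in `Σ₂ᴾ`. -/
def InPi2P (A : Language Bool) : Prop :=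
  InSigma2P Aᶜ

/-!
Both memberships are shown by one nondeterministic guess followed by a universal check; what has to
be found is a description of the guess that makes the check simple.

Let `M` have `n` states. A set `P` of states gives the languages `L₁` of the words that lead from the
initial state into `P`, and `L₂` of the words that are accepted from all states in `P`, and always
`L₁ L₂ ⊆ L(M)`. If `L(M)` is a product, then the set `P` of the states reached by the words of the
first factor yields larger factors. Hence a nonempty language `L(M)` is decomposable if and only if
there is a set `P` such that all words of `L(M)` split at a state of `P`, and one word of `L(M)`
splits into two nonempty parts, which makes both factors different from `{ε}`
(`PartialDFA.isDecomposable_iff`); the empty language is the product of itself with itself. By the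
pumping lemma, `L(M)` is infinite if and only if it contains a word with more than `n` and at most
`2 * n + 1` letters (`PartialDFA.infinite_of_acc`, `PartialDFA.exists_acc_of_infinite`). So the
existential string is a set `P` with a word that splits strictly, or with a long word that disproves
finiteness, and the universal string is a word that has to split if it is accepted.

Whether a word is accepted and how it splits is found by reading it from its end, keeping four bits
for each state (`PrimalityTest.Mark`): the bits for the word `a v` at the state `p` depend only on
the bits for `v` at the successor of `p`, and on whether all states of `P` accept `a v`
(`PrimalityTest.readLetter_recsOf`).

That the check takes polynomial time is shown with a small programming language for finitely many
stacks (`StackCmd`). Its loops pop a stack until it is empty, so that all programs terminate. A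
program is disciplined if the body of each loop does not refill the stack of the loop and adds to
the stacks no more, in terms of fixed weights, than the weight of the popped symbol. Then loops do
not increase the total weight, and a disciplined program runs in polynomial time on a Turing machine
(`StackCmd.tm2ComputableInPolyTime`). The program for the check first parses the
automaton, rejecting malformed descriptions, and then reads the two words; all its loops are
disciplined, which is a finite computation on the text of the program
(`PrimalityTest.polyTimeDecidable_relation`).
-/

/-! ### A programming language for stacks -/

/-- Commands of a small imperative language over finitely many stacks and a register. The language
is total: `loop k f c` pops the symbols of the stack `k` one after another, and `c` is run after
each of them. -/
inductive StackCmd {K : Type} (Γ : K → Type) (σ : Type) : Type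
  /-- Replace the register by its image under `f`. -/
  | load (f : σ → σ)
  /-- Push a symbol that depends on the register. -/
  | push (k : K) (f : σ → Γ k)
  /-- Run two commands in succession. -/
  | seq (c d : StackCmd Γ σ)
  /-- Branch on a property of the register. -/
  | branch (p : σ → Bool) (c d : StackCmd Γ σ)
  /-- If the stack `k` is nonempty, pop a symbol, feed it into the register and run `c`; otherwise
  run `d`. -/
  | case (k : K) (f : σ → Γ k → σ) (c d : StackCmd Γ σ)
  /-- While the stack `k` is nonempty, pop a symbol, feed it into the register and run `c`. -/
  | loop (k : K) (f : σ → Γ k → σ) (c : StackCmd Γ σ)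

namespace StackCmd

/-- Run two commands in succession. -/
scoped infixr:60 " ;; " => StackCmd.seq

variable {K : Type} {Γ : K → Type} {σ : Type}

/-- The weighted total height of the stacks. -/
def size [Fintype K] (w : K → ℕ) (S : ∀ k, List (Γ k)) : ℕ :=
  ∑ k, w k * (S k).length

theorem length_le_size [Fintype K] {w : K → ℕ} {k : K} (hk : 0 < w k) (S : ∀ k, List (Γ k)) :
    (S k).length ≤ size w S := by
  refine le_trans ?_ (Finset.single_le_sum (f := fun k => w k * (S k).length)
    (fun _ _ => Nat.zero_le _) (Finset.mem_univ k))
  exact Nat.le_mul_of_pos_left _ hk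

variable [DecidableEq K]

/-- The function on states (register and stacks) computed by a command. The body of a loop is
iterated as often as the initial height of its stack; superfluous rounds do nothing. -/
def eval : StackCmd Γ σ → σ × (∀ k, List (Γ k)) → σ × (∀ k, List (Γ k))
  | load f, s => (f s.1, s.2)
  | push k f, s => (s.1, Function.update s.2 k (f s.1 :: s.2 k))
  | seq c d, s => d.eval (c.eval s)
  | branch p c d, s => if p s.1 then c.eval s else d.eval s
  | case k f c d, s =>
    match s.2 k with
    | [] => d.eval s
    | a :: l => c.eval (f s.1 a, Function.update s.2 k l)
  | loop k f c, s =>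
    (fun s : σ × (∀ k, List (Γ k)) =>
      match s.2 k with
      | [] => s
      | a :: l => c.eval (f s.1 a, Function.update s.2 k l))^[(s.2 k).length] s

/-- The command contains no push onto the stack `k`. -/
def noPush (k : K) : StackCmd Γ σ → Bool
  | load _ => true
  | push k' _ => k ≠ k'
  | seq c d => c.noPush k && d.noPush k
  | branch _ c d => c.noPush k && d.noPush k
  | case _ _ c d => c.noPush k && d.noPush k
  | loop _ _ c => c.noPush k

/-- A bound for the change of the weighted size of the stacks, provided that the bodies of all
loops use up no more than the weight of the symbol that was popped. -/
def growth (w : K → ℕ) : StackCmd Γ σ → ℤ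
  | load _ => 0
  | push k _ => w k
  | seq c d => c.growth w + d.growth w
  | branch _ c d => max (c.growth w) (d.growth w)
  | case k _ c d => max (c.growth w - w k) (d.growth w)
  | loop _ _ _ => 0

/-- The resource discipline that makes a command run in polynomial time: the body of a loop does
not refill the stack of the loop, and the weight that it adds is at most the weight of the symbol
that was popped. -/
def Disciplined (w : K → ℕ) : StackCmd Γ σ → Bool
  | load _ => true
  | push _ _ => true
  | seq c d => c.Disciplined w && d.Disciplined w
  | branch _ c d => c.Disciplined w && d.Disciplined w
  | case _ _ c d => c.Disciplined w && d.Disciplined w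
  | loop k _ c => c.Disciplined w && c.noPush k && decide (c.growth w ≤ w k) && decide (0 < w k)

theorem length_eval_le {k : K} : ∀ (c : StackCmd Γ σ), c.noPush k = true →
    ∀ s, ((c.eval s).2 k).length ≤ (s.2 k).length := by
  intro c
  induction c with
  | load f => intro _ s; simp [eval]
  | push k' f =>
    intro h s
    simp only [noPush, decide_eq_true_eq] at h
    simp [eval, Function.update_of_ne h]
  | seq c d hc hd =>
    intro h s
    simp only [noPush, Bool.and_eq_true] at h
    exact (hd h.2 _).trans (hc h.1 _)
  | branch p c d hc hd =>
    intro h s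
    simp only [noPush, Bool.and_eq_true] at h
    simp only [eval]
    split_ifs
    · exact hc h.1 _
    · exact hd h.2 _
  | case k' f c d hc hd =>
    intro h s
    simp only [noPush, Bool.and_eq_true] at h
    simp only [eval]
    split
    · exact hd h.2 _
    · rename_i a l hl
      refine (hc h.1 _).trans ?_
      by_cases hk : k = k'
      · subst hk; simp [hl]
      · simp [Function.update_of_ne hk]
  | loop k' f c hc =>
    intro h s
    simp only [noPush] at h
    simp only [eval]
    generalize (s.2 k').length = n
    induction n generalizing s with
    | zero => simp
    | succ n ih =>
      rw [Function.iterate_succ_apply]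
      refine (ih _).trans ?_
      split
      · exact le_rfl
      · rename_i a l hl
        refine (hc h _).trans ?_
        by_cases hk : k = k'
        · subst hk; simp [hl]
        · simp [Function.update_of_ne hk]

theorem eval_loop_nil {k : K} {f : σ → Γ k → σ} {c : StackCmd Γ σ} {s : σ × (∀ k, List (Γ k))}
    (h : s.2 k = []) : (loop k f c).eval s = s := by
  simp [eval, h]

/-- Running a loop on a nonempty stack is running its body once and then the loop again. -/
theorem eval_loop_cons {k : K} {f : σ → Γ k → σ} {c : StackCmd Γ σ} {s : σ × (∀ k, List (Γ k))}
    {a : Γ k} {l : List (Γ k)} (hc : c.noPush k = true) (h : s.2 k = a :: l) :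
    (loop k f c).eval s = (loop k f c).eval (c.eval (f s.1 a, Function.update s.2 k l)) := by
  have stay : ∀ (n : ℕ) (s : σ × (∀ k, List (Γ k))), s.2 k = [] →
      (fun s : σ × (∀ k, List (Γ k)) =>
        match s.2 k with
        | [] => s
        | a :: l => c.eval (f s.1 a, Function.update s.2 k l))^[n] s = s := by
    intro n s hs
    exact Function.iterate_fixed (by simp [hs]) n
  -- More rounds than the height of the stack give the same result.
  have more : ∀ (n m : ℕ) (s : σ × (∀ k, List (Γ k))), (s.2 k).length ≤ n → n ≤ m →
      (fun s : σ × (∀ k, List (Γ k)) =>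
        match s.2 k with
        | [] => s
        | a :: l => c.eval (f s.1 a, Function.update s.2 k l))^[n] s =
      (fun s : σ × (∀ k, List (Γ k)) =>
        match s.2 k with
        | [] => s
        | a :: l => c.eval (f s.1 a, Function.update s.2 k l))^[m] s := by
    intro n
    induction n with
    | zero =>
      intro m s hs _
      rw [stay m s (List.length_eq_zero_iff.1 (Nat.le_zero.1 hs))]
      rfl
    | succ n ih =>
      intro m s hs hm
      obtain ⟨m, rfl⟩ : ∃ m', m = m' + 1 := ⟨m - 1, by omega⟩
      rw [Function.iterate_succ_apply, Function.iterate_succ_apply]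
      apply ih _ _ _ (by omega)
      rcases hl : s.2 k with _ | ⟨a, l⟩
      · simp [hl]
      · simp only []
        refine (length_eval_le c hc _).trans ?_
        simp only [hl, List.length_cons] at hs
        simp only [Function.update_self]
        omega
  -- After the first round, the number of rounds may exceed the height that the stack now has.
  rw [eval, eval, h, List.length_cons, Function.iterate_succ_apply]
  simp only [h]
  refine (more _ _ _ le_rfl ?_).symm
  refine (length_eval_le c hc _).trans ?_
  simp

section Size

variable [Fintype K]

theorem size_update (w : K → ℕ) (S : ∀ k, List (Γ k)) (k : K) (l : List (Γ k)) :
    size w (Function.update S k l) + w k * (S k).length = size w S + w k * l.length := by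
  unfold size
  rw [Fintype.sum_eq_add_sum_compl k, Fintype.sum_eq_add_sum_compl k (fun k => w k * (S k).length)]
  have : ∑ i ∈ {k}ᶜ, w i * (Function.update S k l i).length = ∑ i ∈ {k}ᶜ, w i * (S i).length :=
    Finset.sum_congr rfl fun i hi => by
      rw [Function.update_of_ne (by simpa using hi)]
  rw [this, Function.update_self]
  ring

/-- A disciplined command increases the size at most by its growth. -/
theorem size_eval_le {w : K → ℕ} : ∀ (c : StackCmd Γ σ), c.Disciplined w = true →
    ∀ s, (size w (c.eval s).2 : ℤ) ≤ size w s.2 + c.growth w := by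
  have pop : ∀ {k : K} {a : Γ k} {l : List (Γ k)} {S : ∀ k, List (Γ k)}, S k = a :: l →
      (size w (Function.update S k l) : ℤ) = size w S - w k := by
    intro k a l S h
    have := size_update w S k l
    rw [h, List.length_cons] at this
    zify at this
    linarith
  intro c
  induction c with
  | load f => intro _ s; simp [eval, growth]
  | push k f =>
    intro _ s
    have := size_update w s.2 k (f s.1 :: s.2 k)
    simp only [eval, growth]
    rw [List.length_cons] at this
    zify at this
    linarith
  | seq c d hc hd =>
    intro h s
    simp only [Disciplined, Bool.and_eq_true] at h
    have h1 := hc h.1 s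
    have h2 := hd h.2 (c.eval s)
    simp only [eval, growth]
    linarith
  | branch p c d hc hd =>
    intro h s
    simp only [Disciplined, Bool.and_eq_true] at h
    have h1 := hc h.1 s
    have h2 := hd h.2 s
    simp only [eval, growth]
    split_ifs
    · exact h1.trans (by gcongr; exact le_max_left _ _)
    · exact h2.trans (by gcongr; exact le_max_right _ _)
  | case k f c d hc hd =>
    intro h s
    simp only [Disciplined, Bool.and_eq_true] at h
    simp only [eval, growth]
    split
    · exact (hd h.2 s).trans (by gcongr; exact le_max_right _ _)
    · rename_i a l hl
      have h1 := hc h.1 (f s.1 a, Function.update s.2 k l)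
      rw [pop hl] at h1
      have := le_max_left (c.growth w - w k) (d.growth w)
      linarith
  | loop k f c hc =>
    intro h s
    simp only [Disciplined, Bool.and_eq_true, decide_eq_true_eq] at h
    obtain ⟨⟨⟨h1, -⟩, h2⟩, -⟩ := h
    simp only [eval, growth, add_zero]
    generalize (s.2 k).length = n
    induction n generalizing s with
    | zero => simp
    | succ n ih =>
      rw [Function.iterate_succ_apply]
      refine (ih _).trans ?_
      split
      · exact le_rfl
      · rename_i a l hl
        have h3 := hc h1 (f s.1 a, Function.update s.2 k l)
        rw [pop hl] at h3
        linarith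

end Size

/-! ### Translation into Turing machines -/

/-- The labels needed by a command: one for each of its loops. -/
def Label : StackCmd Γ σ → Type
  | load _ => Empty
  | push _ _ => Empty
  | seq c d => c.Label ⊕ d.Label
  | branch _ c d => c.Label ⊕ d.Label
  | case _ _ c d => c.Label ⊕ d.Label
  | loop _ _ c => Option c.Label

/-- There are finitely many labels. -/
@[reducible]
def labelFintype : ∀ c : StackCmd Γ σ, Fintype c.Label
  | load _ => inferInstanceAs (Fintype Empty)
  | push _ _ => inferInstanceAs (Fintype Empty)
  | seq c d =>
    letI := c.labelFintype
    letI := d.labelFintype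
    inferInstanceAs (Fintype (c.Label ⊕ d.Label))
  | branch _ c d =>
    letI := c.labelFintype
    letI := d.labelFintype
    inferInstanceAs (Fintype (c.Label ⊕ d.Label))
  | case _ _ c d =>
    letI := c.labelFintype
    letI := d.labelFintype
    inferInstanceAs (Fintype (c.Label ⊕ d.Label))
  | loop _ _ c =>
    letI := c.labelFintype
    inferInstanceAs (Fintype (Option c.Label))

/-- The internal state of the machine is the register together with a bit that is only used to test
whether a stack is empty. This is the statement "if the stack `k` is nonempty, pop a symbol, feed it
into the register and do `q`; otherwise do `q'`". -/
def popStmt {Λ : Type} (k : K) (f : σ → Γ k → σ) (q q' : TM2.Stmt Γ Λ (σ × Bool)) :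
    TM2.Stmt Γ Λ (σ × Bool) :=
  .peek k (fun v o => (v.1, o.isSome)) <| .branch (fun v => v.2)
    (.pop k (fun v o => (o.elim v.1 (f v.1), false)) q) q'

/-- The statement that runs a command and then goes on with the statement `q`, where `e` says which
label is the head of which loop. -/
def code {Λ : Type} : ∀ c : StackCmd Γ σ, (c.Label → Λ) → TM2.Stmt Γ Λ (σ × Bool) →
    TM2.Stmt Γ Λ (σ × Bool)
  | load f, _, q => .load (fun v => (f v.1, v.2)) q
  | push k f, _, q => .push k (fun v => f v.1) q
  | seq c d, e, q => c.code (fun l => e (.inl l)) (d.code (fun l => e (.inr l)) q)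
  | branch p c d, e, q =>
    .branch (fun v => p v.1) (c.code (fun l => e (.inl l)) q) (d.code (fun l => e (.inr l)) q)
  | case k f c d, e, q =>
    popStmt k f (c.code (fun l => e (.inl l)) q) (d.code (fun l => e (.inr l)) q)
  | loop _ _ _, e, _ => .goto fun _ => e none

/-- The statement at the head of each loop of a command that is followed by the statement `q`. -/
def loopCode {Λ : Type} : ∀ c : StackCmd Γ σ, (c.Label → Λ) → TM2.Stmt Γ Λ (σ × Bool) →
    c.Label → TM2.Stmt Γ Λ (σ × Bool)
  | load _, _, _, l => l.elim
  | push _ _, _, _, l => l.elim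
  | seq c d, e, q, l => l.elim
      (c.loopCode (fun l => e (.inl l)) (d.code (fun l => e (.inr l)) q))
      (d.loopCode (fun l => e (.inr l)) q)
  | branch _ c d, e, q, l => l.elim
      (c.loopCode (fun l => e (.inl l)) q) (d.loopCode (fun l => e (.inr l)) q)
  | case _ _ c d, e, q, l => l.elim
      (c.loopCode (fun l => e (.inl l)) q) (d.loopCode (fun l => e (.inr l)) q)
  | loop k f c, e, q, l => l.elim
      (popStmt k f (c.code (fun l => e (some l)) (.goto fun _ => e none)) q)
      (c.loopCode (fun l => e (some l)) (.goto fun _ => e none))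

theorem stepAux_popStmt_nil {Λ : Type} {k : K} {f : σ → Γ k → σ}
    {q q' : TM2.Stmt Γ Λ (σ × Bool)} {v : σ} {S : ∀ k, List (Γ k)} (h : S k = []) :
    TM2.stepAux (popStmt k f q q') (v, false) S = TM2.stepAux q' (v, false) S := by
  simp [popStmt, h]

theorem stepAux_popStmt_cons {Λ : Type} {k : K} {f : σ → Γ k → σ}
    {q q' : TM2.Stmt Γ Λ (σ × Bool)} {v : σ} {S : ∀ k, List (Γ k)} {a : Γ k} {l : List (Γ k)}
    (h : S k = a :: l) :
    TM2.stepAux (popStmt k f q q') (v, false) S =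
      TM2.stepAux q (f v a, false) (Function.update S k l) := by
  simp [popStmt, h]

/-- `Reach M t a b`: the machine `M` goes from the configuration `a` to `b` in exactly `t` steps. -/
def Reach {Λ τ : Type} (M : Λ → TM2.Stmt Γ Λ τ) (t : ℕ) (a b : TM2.Cfg Γ Λ τ) : Prop :=
  (flip bind (TM2.step M))^[t] (some a) = some b

theorem Reach.trans {Λ τ : Type} {M : Λ → TM2.Stmt Γ Λ τ} {t u : ℕ} {a b c : TM2.Cfg Γ Λ τ}
    (h₁ : Reach M t a b) (h₂ : Reach M u b c) : Reach M (u + t) a c := by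
  unfold Reach at *
  rw [Function.iterate_add_apply, h₁, h₂]

theorem Reach.step {Λ τ : Type} {M : Λ → TM2.Stmt Γ Λ τ} {l : Λ} {v : τ} {S : ∀ k, List (Γ k)} :
    Reach M 1 ⟨some l, v, S⟩ (TM2.stepAux (M l) v S) := rfl

variable [Fintype K]

/-- A disciplined command is executed by its translation in polynomial time. -/
theorem exists_reach_code {Λ : Type} (M : Λ → TM2.Stmt Γ Λ (σ × Bool)) {w : K → ℕ} :
    ∀ (c : StackCmd Γ σ), c.Disciplined w = true →
    ∀ (e : c.Label → Λ) (q : TM2.Stmt Γ Λ (σ × Bool)), (∀ l, M (e l) = c.loopCode e q l) →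
    ∃ p : Polynomial ℕ, ∀ N s, size w s.2 ≤ N → ∃ t ≤ p.eval N,
      Reach M t (TM2.stepAux (c.code e q) (s.1, false) s.2)
        (TM2.stepAux q ((c.eval s).1, false) (c.eval s).2) := by
  intro c
  induction c with
  | load f => exact fun _ e q _ => ⟨0, fun N s _ => ⟨0, by simp, rfl⟩⟩
  | push k f => exact fun _ e q _ => ⟨0, fun N s _ => ⟨0, by simp, rfl⟩⟩
  | seq c d hc hd =>
    intro h e q hM
    simp only [Disciplined, Bool.and_eq_true] at h
    obtain ⟨p₁, h₁⟩ := hc h.1 _ _ fun l => hM (.inl l)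
    obtain ⟨p₂, h₂⟩ := hd h.2 _ _ fun l => hM (.inr l)
    -- The second command starts with stacks that the first one may have enlarged by its growth.
    refine ⟨p₂.comp (.X + .C (c.growth w).toNat) + p₁, fun N s hs => ?_⟩
    obtain ⟨t₁, ht₁, r₁⟩ := h₁ N s hs
    obtain ⟨t₂, ht₂, r₂⟩ := h₂ (N + (c.growth w).toNat) (c.eval s) (by
      have := size_eval_le c h.1 s
      have := Int.self_le_toNat (c.growth w)
      omega)
    exact ⟨t₂ + t₁, by simpa using add_le_add ht₂ ht₁, r₁.trans r₂⟩
  | branch p c d hc hd =>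
    intro h e q hM
    simp only [Disciplined, Bool.and_eq_true] at h
    obtain ⟨p₁, h₁⟩ := hc h.1 _ _ fun l => hM (.inl l)
    obtain ⟨p₂, h₂⟩ := hd h.2 _ _ fun l => hM (.inr l)
    refine ⟨p₁ + p₂, fun N s hs => ?_⟩
    obtain ⟨t₁, ht₁, r₁⟩ := h₁ N s hs
    obtain ⟨t₂, ht₂, r₂⟩ := h₂ N s hs
    simp only [code, TM2.stepAux, eval, Polynomial.eval_add]
    cases p s.1
    · exact ⟨t₂, by omega, r₂⟩
    · exact ⟨t₁, by omega, r₁⟩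
  | case k f c d hc hd =>
    intro h e q hM
    simp only [Disciplined, Bool.and_eq_true] at h
    obtain ⟨p₁, h₁⟩ := hc h.1 _ _ fun l => hM (.inl l)
    obtain ⟨p₂, h₂⟩ := hd h.2 _ _ fun l => hM (.inr l)
    refine ⟨p₁ + p₂, fun N s hs => ?_⟩
    simp only [code, eval, Polynomial.eval_add]
    split
    · rename_i hl
      rw [stepAux_popStmt_nil hl]
      obtain ⟨t₂, ht₂, r₂⟩ := h₂ N s hs
      exact ⟨t₂, by omega, r₂⟩
    · rename_i a l hl
      rw [stepAux_popStmt_cons hl]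
      have := size_update w s.2 k l
      rw [hl, List.length_cons, mul_add] at this
      obtain ⟨t₁, ht₁, r₁⟩ := h₁ N (f s.1 a, Function.update s.2 k l) (by dsimp only; omega)
      exact ⟨t₁, by omega, r₁⟩
  | loop k f c hc =>
    intro h e q hM
    have hloop := h
    simp only [Disciplined, Bool.and_eq_true, decide_eq_true_eq] at h
    obtain ⟨⟨⟨h1, h2⟩, h3⟩, h4⟩ := h
    obtain ⟨p, hp⟩ := hc h1 _ _ fun l => hM (some l)
    -- The size never exceeds `N` at the head of the loop, and there are at most `N` rounds.
    refine ⟨.X * (1 + p) + 1, fun N s hs => ?_⟩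
    have head : M (e none) =
        popStmt k f (c.code (fun l => e (some l)) (.goto fun _ => e none)) q := hM none
    have main : ∀ m s, (s.2 k).length ≤ m → size w s.2 ≤ N → ∃ t ≤ m * (1 + p.eval N) + 1,
        Reach M t ⟨some (e none), (s.1, false), s.2⟩
          (TM2.stepAux q (((loop k f c).eval s).1, false) ((loop k f c).eval s).2) := by
      intro m
      induction m with
      | zero =>
        intro s hm hs
        have hnil : s.2 k = [] := List.length_eq_zero_iff.1 (Nat.le_zero.1 hm)
        refine ⟨1, by simp, ?_⟩
        rw [eval_loop_nil hnil, ← stepAux_popStmt_nil (f := f) hnil, ← head]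
        exact Reach.step
      | succ m ih =>
        intro s hm hs
        rcases hl : s.2 k with _ | ⟨a, l⟩
        · refine ⟨1, by simp, ?_⟩
          rw [eval_loop_nil hl, ← stepAux_popStmt_nil (f := f) hl, ← head]
          exact Reach.step
        · have hsz := size_update w s.2 k l
          rw [hl, List.length_cons, mul_add] at hsz
          have hsz' := size_eval_le c h1 (f s.1 a, Function.update s.2 k l)
          obtain ⟨t₁, ht₁, r₁⟩ := hp N (f s.1 a, Function.update s.2 k l) (by dsimp only; omega)
          obtain ⟨t₂, ht₂, r₂⟩ := ih (c.eval (f s.1 a, Function.update s.2 k l))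
            ((length_eval_le c h2 _).trans (by
              rw [hl, List.length_cons] at hm
              simpa using Nat.le_of_succ_le_succ hm)) (by dsimp only at hsz'; omega)
          have r₀ := Reach.step (M := M) (l := e none) (v := (s.1, false)) (S := s.2)
          rw [head, stepAux_popStmt_cons hl] at r₀
          refine ⟨t₂ + (t₁ + 1), by rw [add_mul]; omega, ?_⟩
          rw [eval_loop_cons h2 hl]
          exact (r₀.trans r₁).trans r₂
    obtain ⟨t, ht, r⟩ := main N s ((length_le_size h4 s.2).trans hs) hs
    exact ⟨t, by simpa using ht, r⟩

/-- The Turing machine that runs a command. -/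
def toTM [Fintype σ] (c : StackCmd Γ σ) (k₀ k₁ : K) [Fintype (Γ k₀)] (v₀ : σ) : FinTM2 :=
  letI := c.labelFintype
  { K := K
    k₀ := k₀
    k₁ := k₁
    Γ := Γ
    Λ := Option c.Label
    main := none
    σ := σ × Bool
    initialState := (v₀, false)
    m := fun l => l.elim (c.code some .halt) (c.loopCode some .halt) }

/-- The stacks are all empty, except that the stack `k` has the contents `l`. -/
def single (k : K) (l : List (Γ k)) : ∀ k, List (Γ k) :=
  Function.update (fun _ => []) k l

/-- A function computed by a disciplined command is computed by a Turing machine in polynomial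
time. -/
theorem tm2ComputableInPolyTime [Fintype σ] {α β αΓ βΓ : Type} {ea : α → List αΓ}
    {eb : β → List βΓ} {f : α → β} (c : StackCmd Γ σ) (k₀ k₁ : K) [Fintype (Γ k₀)] (v₀ : σ)
    (i : Γ k₀ ≃ αΓ) (o : Γ k₁ ≃ βΓ) {w : K → ℕ} (hc : c.Disciplined w = true)
    (h : ∀ a, c.eval (v₀, single k₀ ((ea a).map i.symm)) =
      (v₀, single k₁ ((eb (f a)).map o.symm))) :
    Nonempty (TM2ComputableInPolyTime ea eb f) := by
  let M : Option c.Label → TM2.Stmt Γ (Option c.Label) (σ × Bool) :=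
    fun l => l.elim (c.code some .halt) (c.loopCode some .halt)
  obtain ⟨p, hp⟩ := exists_reach_code M c hc some .halt fun l => rfl
  have hsingle : ∀ (k : K) (l : List (Γ k)),
      (fun k' => @dite (List (Γ k')) (k' = k) (inferInstance) (fun h => by rw [h]; exact l)
        fun _ => []) = single k l := by
    intro k l
    funext k'
    by_cases hk : k' = k
    · subst hk; simp [single]
    · simp [single, hk]
  refine ⟨{ tm := toTM c k₀ k₁ v₀
            inputAlphabet := i
            outputAlphabet := o
            time := p.comp (.C (w k₀) * .X) + 1
            outputsFun := fun a => Nonempty.some ?_ }⟩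
  obtain ⟨t, ht, r⟩ := hp (w k₀ * (ea a).length) (v₀, single k₀ ((ea a).map i.symm)) (by
    have := size_update w (fun k => ([] : List (Γ k))) k₀ ((ea a).map i.symm)
    simp only [size, single] at this ⊢
    simp at this
    simp [this])
  rw [h a] at r
  -- The label `none` of the machine is its start; the step from there is not counted in `t`.
  have r' := (Reach.step (M := M) (l := none) (v := (v₀, false))
    (S := single k₀ ((ea a).map i.symm))).trans r
  refine ⟨⟨⟨t + 1, ?_⟩, ?_⟩⟩
  · have e₁ : initList (toTM c k₀ k₁ v₀) ((ea a).map i.symm) =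
        ⟨some none, (v₀, false), single k₀ ((ea a).map i.symm)⟩ :=
      congrArg (fun S => (⟨some none, (v₀, false), S⟩ : TM2.Cfg Γ (Option c.Label) (σ × Bool)))
        (hsingle _ _)
    have e₂ : haltList (toTM c k₀ k₁ v₀) ((eb (f a)).map o.symm) =
        ⟨none, (v₀, false), single k₁ ((eb (f a)).map o.symm)⟩ :=
      congrArg (fun S => (⟨none, (v₀, false), S⟩ : TM2.Cfg Γ (Option c.Label) (σ × Bool)))
        (hsingle _ _)
    change (flip bind _)^[t + 1] (some (initList (toTM c k₀ k₁ v₀) ((ea a).map i.symm))) =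
      some (haltList (toTM c k₀ k₁ v₀) ((eb (f a)).map o.symm))
    rw [e₁, e₂]
    exact r'
  · simpa using ht

end StackCmd

namespace PrimalityTest

open StackCmd

/-! ### Data of the program -/

/-- What is recorded about a state `p` for the word `v` read so far, where the splittings of `v`
are those at a selected state (see `PartialDFA.SplitsInto`): `v` is accepted from `p`
(`acc`), `v` splits from `p` (`split`), `v` splits from `p` with a nonempty second part (`inner`),
and `v` splits from `p` with two nonempty parts (`strict`). -/
structure Mark where
  acc : Bool
  split : Bool
  inner : Bool
  strict : Bool
  deriving Fintype, Inhabited, DecidableEq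

/-- The record of a state: whether it is initial, accepting, and selected, and its current mark. -/
structure Rec where
  start : Bool
  final : Bool
  sel : Bool
  mark : Mark
  deriving Fintype, Inhabited, DecidableEq

/-- The symbols of the transition table: an entry `t` is written as `t` ticks and an end marker, and
each row is followed by a further end marker. -/
inductive TSym
  | tick
  | entry
  | row
  deriving Inhabited, DecidableEq

instance : Fintype TSym := ⟨{.tick, .entry, .row}, fun x => by cases x <;> decide⟩

/-- The part of the input that is being read. -/
inductive Phase
  | states
  | letters
  | start
  | head
  | entry
  deriving Inhabited, DecidableEq

instance : Fintype Phase :=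
  ⟨{.states, .letters, .start, .head, .entry}, fun x => by cases x <;> decide⟩

/-- The stacks. Besides input and output there are stacks for the three strings, a stack for a word,
the transition table, the records of the states, the marks fetched from the table, and three
counters; a primed stack holds what has been taken from the corresponding stack during a pass. -/
inductive Stk
  | inp | out | X | Y | Z | W | T | T' | V | V' | U | N | N' | K | K' | A | A'
  deriving DecidableEq

instance : Fintype Stk :=
  ⟨{.inp, .out, .X, .Y, .Z, .W, .T, .T', .V, .V', .U, .N, .N', .K, .K', .A, .A'},
    fun x => by cases x <;> decide⟩

/-- The alphabets of the stacks. -/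
abbrev Γ : Stk → Type
  | .inp => Bool ⊕ Bool ⊕ Bool
  | .out | .X | .Y | .Z | .W => Bool
  | .T | .T' => TSym
  | .V | .V' => Rec
  | .U => Mark
  | .N | .N' | .K | .K' | .A | .A' => Unit

/-- The flags of the program. While the automaton is parsed, `phase` says which number is being read,
`fin` is the acceptance bit of the current row, and `err` reports malformed input. While a word is
read, `long` says that it has more letters than there are states, `hit` that the entry for the
current letter has been found in the current row, `cur` is the mark found there, and `sub` says
whether all selected states seen so far accept. The marks and lengths of the two words are kept in
`res'`, `long'` and `res`, `long`, and `ans` is the answer. -/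
structure Reg where
  phase : Phase
  fin : Bool
  err : Bool
  long : Bool
  sub : Bool
  hit : Bool
  cur : Mark
  res : Mark
  res' : Mark
  long' : Bool
  ans : Bool
  deriving Inhabited

noncomputable instance : Fintype Reg :=
  Fintype.ofInjective
    (fun r => ((r.phase, r.fin, r.err, r.long), (r.sub, r.hit, r.cur),
      (r.res, r.res', r.long', r.ans)))
    fun r r' h => by
      cases r
      cases r'
      simpa [and_assoc] using h

/-- A buffer for symbols that have just been popped. -/
structure Buf where
  i : Bool ⊕ Bool ⊕ Bool
  b : Bool
  t : TSym
  r : Rec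
  m : Mark
  deriving Fintype

instance : Inhabited Buf := ⟨⟨.inl false, default, default, default, default⟩⟩

/-- The buffer that holds a record. -/
@[simp]
def bufRec (a : Rec) : Buf := { (default : Buf) with r := a }

/-- The buffer that holds a symbol of the table. -/
@[simp]
def bufSym (a : TSym) : Buf := { (default : Buf) with t := a }

/-- The buffer that holds a bit. -/
@[simp]
def bufBit (a : Bool) : Buf := { (default : Buf) with b := a }

/-- Put a popped input symbol into the buffer. -/
@[simp]
def popInp (v : Reg × Buf) (a : Bool ⊕ Bool ⊕ Bool) : Reg × Buf := (v.1, { v.2 with i := a })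

/-- Put a popped bit into the buffer. -/
@[simp]
def popBit (v : Reg × Buf) (a : Bool) : Reg × Buf := (v.1, { v.2 with b := a })

/-- Put a popped symbol of the table into the buffer. -/
@[simp]
def popSym (v : Reg × Buf) (a : TSym) : Reg × Buf := (v.1, { v.2 with t := a })

/-- Put a popped record into the buffer. -/
@[simp]
def popRec (v : Reg × Buf) (a : Rec) : Reg × Buf := (v.1, { v.2 with r := a })

/-- Put a popped mark into the buffer. -/
@[simp]
def popMark (v : Reg × Buf) (a : Mark) : Reg × Buf := (v.1, { v.2 with m := a })

/-- Drop a popped symbol of a counter. -/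
@[simp]
def popUnit (v : Reg × Buf) (_ : Unit) : Reg × Buf := v

/-- Programs over these stacks. -/
abbrev Prog := StackCmd Γ (Reg × Buf)

/-- The contents of the stacks. -/
structure St where
  inp : List (Bool ⊕ Bool ⊕ Bool)
  out : List Bool
  X : List Bool
  Y : List Bool
  Z : List Bool
  W : List Bool
  T : List TSym
  T' : List TSym
  V : List Rec
  V' : List Rec
  U : List Mark
  N : List Unit
  N' : List Unit
  K : List Unit
  K' : List Unit
  A : List Unit
  A' : List Unit

namespace St

/-- The family of stacks that belongs to given contents. -/
def get (s : St) : ∀ k, List (Γ k)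
  | .inp => s.inp
  | .out => s.out
  | .X => s.X
  | .Y => s.Y
  | .Z => s.Z
  | .W => s.W
  | .T => s.T
  | .T' => s.T'
  | .V => s.V
  | .V' => s.V'
  | .U => s.U
  | .N => s.N
  | .N' => s.N'
  | .K => s.K
  | .K' => s.K'
  | .A => s.A
  | .A' => s.A'

/-- Replace the contents of one stack. -/
def set (s : St) : ∀ k, List (Γ k) → St
  | .inp, l => { s with inp := l }
  | .out, l => { s with out := l }
  | .X, l => { s with X := l }
  | .Y, l => { s with Y := l }
  | .Z, l => { s with Z := l }
  | .W, l => { s with W := l }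
  | .T, l => { s with T := l }
  | .T', l => { s with T' := l }
  | .V, l => { s with V := l }
  | .V', l => { s with V' := l }
  | .U, l => { s with U := l }
  | .N, l => { s with N := l }
  | .N', l => { s with N' := l }
  | .K, l => { s with K := l }
  | .K', l => { s with K' := l }
  | .A, l => { s with A := l }
  | .A', l => { s with A' := l }

theorem update_get (s : St) (k : Stk) (l : List (Γ k)) :
    Function.update s.get k l = (s.set k l).get := by
  funext k'
  by_cases h : k' = k
  · subst h; rw [Function.update_self]; cases k' <;> rfl
  · rw [Function.update_of_ne h]
    cases k <;> cases k' <;> first | rfl | exact absurd rfl h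

/-- All stacks are empty. -/
def empty : St := ⟨[], [], [], [], [], [], [], [], [], [], [], [], [], [], [], [], []⟩

end St

/-! ### Passes over a stack -/

/-- Empty a stack. -/
def clear (k : Stk) : Prog := loop k (fun v _ => v) (load id)

theorem eval_clear (k : Stk) (v : Reg × Buf) (s : St) :
    (clear k).eval (v, s.get) = (v, (s.set k []).get) := by
  generalize h : s.get k = l
  induction l generalizing s with
  | nil =>
    rw [clear, eval_loop_nil h, ← St.update_get, ← h, Function.update_eq_self]
  | cons a l ih =>
    rw [clear, eval_loop_cons rfl h, ← clear]
    simp only [eval, id, St.update_get]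
    rw [ih _ (by rw [← St.update_get, Function.update_self]), ← St.update_get, ← St.update_get,
      ← St.update_get, Function.update_idem]

/-- Pop the symbols of the stack `k` one after another; each symbol `a` updates the flags, and
an image of it is pushed onto the stack `k'`. -/
def transfer (k k' : Stk) (upd : Reg → Γ k → Reg) (put : Γ k → Buf) (img : Reg → Buf → Γ k') :
    Prog :=
  loop k (fun v a => (upd v.1 a, put a))
    (push k' (fun v => img v.1 v.2) ;; load fun v => (v.1, default))

theorem eval_transfer {k k' : Stk} (hk : k ≠ k') {upd : Reg → Γ k → Reg} {put : Γ k → Buf}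
    {img : Reg → Buf → Γ k'} (v : Reg) (s : St) (g : Γ k → Γ k')
    (hg : ∀ l₁ a l₂, s.get k = l₁ ++ a :: l₂ → img (upd (l₁.foldl upd v) a) (put a) = g a) :
    (transfer k k' upd put img).eval ((v, default), s.get) =
      (((s.get k).foldl upd v, default),
        ((s.set k' (((s.get k).map g).reverse ++ s.get k')).set k []).get) := by
  have hnp : (push k' (fun v : Reg × Buf => img v.1 v.2) ;;
      load fun v => (v.1, default)).noPush k = true := by
    simp [noPush, hk]
  generalize h : s.get k = l
  induction l generalizing s v with
  | nil =>
    rw [transfer, eval_loop_nil h]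
    simp only [← St.update_get]
    congr 1
    funext j
    by_cases hj : j = k
    · subst hj; simp [h]
    · by_cases hj' : j = k'
      · subst hj'; simp [hj]
      · simp [hj]
  | cons a l ih =>
    rw [transfer, eval_loop_cons hnp h, ← transfer]
    simp only [eval, St.update_get]
    rw [ih _ _ _ (by rw [← St.update_get, ← St.update_get, Function.update_of_ne hk,
      Function.update_self])]
    · have := hg [] a l (by rw [h]; rfl)
      simp only [List.foldl_nil] at this
      simp only [this, List.foldl_cons, ← St.update_get, List.map_cons, List.reverse_cons,
        List.append_assoc, List.singleton_append]
      congr 1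
      funext j
      by_cases hj : j = k
      · subst hj; simp
      · by_cases hj' : j = k'
        · subst hj'; simp [Ne.symm hk]
        · simp [hj, hj']
    · intro l₁ b l₂ e
      have := hg (a :: l₁) b l₂ (by
        rw [← St.update_get, ← St.update_get, Function.update_of_ne hk,
          Function.update_self] at e
        rw [h, e]; rfl)
      exact this

/-- A pass that does not touch the flags. -/
theorem eval_transfer_map {k k' : Stk} (hk : k ≠ k') {put : Γ k → Buf}
    {img : Reg → Buf → Γ k'} (v : Reg) (s : St) :
    (transfer k k' (fun v _ => v) put img).eval ((v, default), s.get) =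
      ((v, default),
        ((s.set k' (((s.get k).map fun a => img v (put a)).reverse ++
          s.get k')).set k []).get) := by
  have hv : ∀ l : List (Γ k), l.foldl (fun v _ => v) v = v := fun l => by simp
  rw [eval_transfer hk v s (fun a => img v (put a)) (fun l₁ a l₂ _ => by rw [hv]), hv]

/-- Add the second counter to the first. -/
def restoreN : Prog := transfer .N' .N (fun v _ => v) (fun _ => default) (fun _ _ => ())

/-- Add the second counter to the first. -/
def restoreK : Prog := transfer .K' .K (fun v _ => v) (fun _ => default) (fun _ _ => ())

/-- Add the second counter to the first. -/
def restoreA : Prog := transfer .A' .A (fun v _ => v) (fun _ => default) (fun _ _ => ())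

theorem replicate_length_unit (l : List Unit) : List.replicate l.length () = l :=
  (List.eq_replicate_iff.2 ⟨rfl, fun _ _ => rfl⟩).symm

theorem reverse_unit (l : List Unit) : l.reverse = l := by
  rw [← replicate_length_unit l, List.reverse_replicate]

theorem eval_restoreN (v : Reg) (s : St) : restoreN.eval ((v, default), s.get) =
    ((v, default), { s with N := s.N' ++ s.N, N' := [] }.get) := by
  rw [restoreN, eval_transfer_map (by decide)]
  simp [St.set, St.get, replicate_length_unit, reverse_unit]

theorem eval_restoreK (v : Reg) (s : St) : restoreK.eval ((v, default), s.get) =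
    ((v, default), { s with K := s.K' ++ s.K, K' := [] }.get) := by
  rw [restoreK, eval_transfer_map (by decide)]
  simp [St.set, St.get, replicate_length_unit, reverse_unit]

theorem eval_restoreA (v : Reg) (s : St) : restoreA.eval ((v, default), s.get) =
    ((v, default), { s with A := s.A' ++ s.A, A' := [] }.get) := by
  rw [restoreA, eval_transfer_map (by decide)]
  simp [St.set, St.get, replicate_length_unit, reverse_unit]

/-- Move the table to another stack. -/
def moveT : Prog := transfer .T .T' (fun v _ => v) bufSym
  (fun _ u => u.t)

/-- Move the records back to their main stack. -/
def rewindV : Prog := transfer .V' .V (fun v _ => v) bufRec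
  (fun _ u => u.r)

/-- Move the records to their secondary stack. -/
def unwindV : Prog := transfer .V .V' (fun v _ => v) bufRec
  (fun _ u => u.r)

theorem eval_rewindV (v : Reg) (s : St) : rewindV.eval ((v, default), s.get) =
    ((v, default), { s with V := s.V'.reverse ++ s.V, V' := [] }.get) := by
  rw [rewindV, eval_transfer_map (by decide)]
  simp [St.set, St.get]

theorem eval_unwindV (v : Reg) (s : St) : unwindV.eval ((v, default), s.get) =
    ((v, default), { s with V' := s.V.reverse ++ s.V', V := [] }.get) := by
  rw [unwindV, eval_transfer_map (by decide)]
  simp [St.set, St.get]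

theorem eval_moveT (v : Reg) (s : St) : moveT.eval ((v, default), s.get) =
    ((v, default), { s with T' := s.T.reverse ++ s.T', T := [] }.get) := by
  rw [moveT, eval_transfer_map (by decide)]
  simp [St.set, St.get]

/-- Do nothing. -/
def skip : Prog := load id

/-- Empty the buffer. -/
def reset : Prog := load fun v => (v.1, default)

/-- Change the flags. -/
def flags (f : Reg → Reg) : Prog := load fun v => (f v.1, v.2)

theorem eval_seq (c d : Prog) (s : (Reg × Buf) × (∀ k, List (Γ k))) :
    (c ;; d).eval s = d.eval (c.eval s) := rfl

theorem eval_flags (f : Reg → Reg) (v : Reg) (u : Buf) (S : ∀ k, List (Γ k)) :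
    (flags f).eval ((v, u), S) = ((f v, u), S) := rfl

theorem eval_reset (v : Reg) (u : Buf) (S : ∀ k, List (Γ k)) :
    reset.eval ((v, u), S) = ((v, default), S) := rfl

theorem eval_branch (p : Reg × Buf → Bool) (c d : Prog) (s : (Reg × Buf) × (∀ k, List (Γ k))) :
    (branch p c d).eval s = if p s.1 then c.eval s else d.eval s := rfl

/-- Move one record to the secondary stack; if there is none, run `d`. -/
def advanceV (d : Prog) : Prog :=
  case .V popRec (push .V' (fun v => v.2.r) ;; reset) d

/-! ### Fetching the marks of the successor states -/

/-- The code of a row of the transition table. -/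
def rowCode (es : List ℕ) : List TSym :=
  es.flatMap (fun t => List.replicate t TSym.tick ++ [.entry]) ++ [.row]

/-- The mark of the state to which the table entry `t` points: `0` points nowhere, and `q + 1`
points to the state `q`. -/
def entryMark (vs : List Rec) : ℕ → Mark
  | 0 => default
  | q + 1 => (vs[q]?).elim default Rec.mark

/-- The mark of the successor state for the letter `a` in a given row of the table. -/
def succMark (vs : List Rec) (a : ℕ) (es : List ℕ) : Mark :=
  (es[a]?).elim default (entryMark vs)

/-- Go through the table and collect, for each row, the mark of the successor state for the letter
on the counter `A`. While an entry is read, the secondary stack of records is as high as the part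
of the entry that has been read, so that the target of the entry ends up on top of it. Each mark is
paid for with a symbol from the stack `K`, which keeps the program disciplined. -/
def fetch : Prog :=
  loop .T' popSym <|
    branch (fun v => v.2.t = .tick) (reset ;; push .T (fun _ => .tick) ;; advanceV skip) <|
    branch (fun v => v.2.t = .entry)
      (reset ;; push .T (fun _ => .entry) ;;
        case .A popUnit (push .A' fun _ => ())
          (branch (fun v => v.1.hit) skip
            (case .V' popRec
              (push .V' (fun v => v.2.r) ;; load fun v => ({ v.1 with cur := v.2.r.mark }, default))
              skip ;;
            flags fun v => { v with hit := true })) ;;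
        rewindV)
      (reset ;; push .T (fun _ => .row) ;; case .K popUnit (push .U fun v => v.1.cur) skip ;;
        flags (fun v => { v with hit := false, cur := default }) ;; restoreA)

theorem replicate_append_cons {α : Type*} (n : ℕ) (a : α) (l : List α) :
    List.replicate n a ++ a :: l = List.replicate (n + 1) a ++ l := by
  rw [List.replicate_succ', List.append_assoc]
  rfl

theorem fetch_ticks (v : Reg) (t : ℕ) (s : St) (rest : List TSym) (ht : t ≤ s.V.length)
    (h : s.T' = List.replicate t TSym.tick ++ rest) :
    fetch.eval ((v, default), s.get) = fetch.eval ((v, default),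
      { s with T' := rest, T := List.replicate t TSym.tick ++ s.T, V := s.V.drop t,
               V' := (s.V.take t).reverse ++ s.V' }.get) := by
  induction t generalizing s with
  | zero => simp at h; simp [← h]
  | succ t ih =>
    rw [List.replicate_succ, List.cons_append] at h
    rw [fetch, eval_loop_cons rfl h, ← fetch]
    obtain ⟨r, l, hl⟩ : ∃ r l, s.V = r :: l := List.exists_cons_of_length_pos (by omega)
    rw [hl] at ht
    simp only [List.length_cons] at ht
    have := ih { s with T' := List.replicate t TSym.tick ++ rest, T := .tick :: s.T, V := l,
                        V' := r :: s.V' } (by dsimp only; omega) rfl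
    simp [eval, advanceV, reset, St.update_get, St.set, St.get, hl] at this ⊢
    rw [this]
    rw [replicate_append_cons]

/-- The entries before the one for the letter on the counter `A` are passed over. -/
theorem fetch_entry_skip (v : Reg) (t : ℕ) (s : St) (rest : List TSym) (ht : t ≤ s.V.length)
    (hV : s.V' = []) (h : s.T' = List.replicate t TSym.tick ++ TSym.entry :: rest) (u : Unit)
    (l : List Unit) (hA : s.A = u :: l) :
    fetch.eval ((v, default), s.get) = fetch.eval ((v, default),
      { s with T' := rest, T := (List.replicate t TSym.tick ++ [TSym.entry]).reverse ++ s.T, A := l,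
               A' := () :: s.A' }.get) := by
  rw [fetch_ticks v t s _ ht h, fetch, eval_loop_cons rfl rfl, ← fetch]
  simp [eval, reset, St.update_get, St.set, St.get, hA, eval_rewindV, hV]

/-- The entries after the one for the letter on the counter `A` are passed over. -/
theorem fetch_entry_hit (v : Reg) (t : ℕ) (s : St) (rest : List TSym) (ht : t ≤ s.V.length)
    (hV : s.V' = []) (h : s.T' = List.replicate t TSym.tick ++ TSym.entry :: rest)
    (hA : s.A = []) (hv : v.hit = true) :
    fetch.eval ((v, default), s.get) = fetch.eval ((v, default),
      { s with
        T' := rest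
        T := (List.replicate t TSym.tick ++ [TSym.entry]).reverse ++ s.T }.get) := by
  rw [fetch_ticks v t s _ ht h, fetch, eval_loop_cons rfl rfl, ← fetch]
  simp [eval, reset, skip, St.update_get, St.set, St.get, hA, eval_rewindV, hV, hv]

/-- At the entry for the letter on the counter `A`, the mark of its target is fetched. -/
theorem fetch_entry_take (v : Reg) (t : ℕ) (s : St) (rest : List TSym) (ht : t ≤ s.V.length)
    (hV : s.V' = []) (h : s.T' = List.replicate t TSym.tick ++ TSym.entry :: rest)
    (hA : s.A = []) (hv : v.hit = false) (hc : v.cur = default) :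
    fetch.eval ((v, default), s.get) =
      fetch.eval (({ v with hit := true, cur := entryMark s.V t }, default),
      { s with
        T' := rest
        T := (List.replicate t TSym.tick ++ [TSym.entry]).reverse ++ s.T }.get) := by
  rw [fetch_ticks v t s _ ht h, fetch, eval_loop_cons rfl rfl, ← fetch]
  rcases t with _ | t
  · simp [eval, reset, skip, flags, St.update_get, St.set, St.get, hA, eval_rewindV, hV, hv,
      entryMark, ← hc]
  · have e : (s.V.take (t + 1)).reverse = s.V[t] :: (s.V.take t).reverse := by
      rw [List.take_add_one, List.getElem?_eq_getElem (show t < s.V.length by omega)]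
      simp
    simp [eval, reset, flags, St.update_get, St.set, St.get, hA, eval_rewindV, hV, hv,
      entryMark, e, List.getElem?_eq_getElem (show t < s.V.length by omega)]

theorem fetch_entries_hit (v : Reg) (es : List ℕ) (s : St) (rest : List TSym)
    (hes : ∀ t ∈ es, t ≤ s.V.length) (hV : s.V' = [])
    (h : s.T' = es.flatMap (fun t => List.replicate t TSym.tick ++ [TSym.entry]) ++ rest)
    (hA : s.A = []) (hv : v.hit = true) :
    fetch.eval ((v, default), s.get) = fetch.eval ((v, default),
      { s with
        T' := rest
        T := (es.flatMap (fun t => List.replicate t TSym.tick ++ [TSym.entry])).reverse ++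
          s.T }.get) := by
  induction es generalizing s with
  | nil => simp at h; simp [← h]
  | cons t es ih =>
    rw [fetch_entry_hit v t s
      (es.flatMap (fun t => List.replicate t TSym.tick ++ [TSym.entry]) ++ rest) (hes t (by simp)) hV (by simp [h]) hA hv, ih]
    · simp
    · exact fun t ht => hes t (by simp [ht])
    · exact hV
    · rfl
    · exact hA

/-- The result of reading the entries of a row when the letter counter is at `a`. -/
theorem fetch_entries (v : Reg) (es : List ℕ) (a a' : ℕ) (s : St) (rest : List TSym)
    (hes : ∀ t ∈ es, t ≤ s.V.length) (hV : s.V' = [])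
    (h : s.T' = es.flatMap (fun t => List.replicate t TSym.tick ++ [TSym.entry]) ++ rest)
    (hA : s.A = List.replicate a ()) (hA' : s.A' = List.replicate a' ()) (hv : v.hit = false)
    (hc : v.cur = default) :
    ∃ (b : Bool) (i j : ℕ), i + j = a + a' ∧
      fetch.eval ((v, default), s.get) =
        fetch.eval (({ v with hit := b, cur := succMark s.V a es }, default),
      { s with
        T' := rest
        T := (es.flatMap (fun t => List.replicate t TSym.tick ++ [TSym.entry])).reverse ++ s.T
        A := List.replicate i ()
        A' := List.replicate j () }.get) := by
  induction es generalizing s a a' with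
  | nil =>
    simp at h
    refine ⟨false, a, a', rfl, ?_⟩
    cases v
    simp only at hv hc
    simp [← h, ← hA, ← hA', succMark, hv, hc]
  | cons t es ih =>
    rcases a with _ | a
    · refine ⟨true, 0, a', rfl, ?_⟩
      rw [fetch_entry_take v t s
        (es.flatMap (fun t => List.replicate t TSym.tick ++ [TSym.entry]) ++ rest)
        (hes t (by simp)) hV (by simp [h]) hA hv hc,
        fetch_entries_hit _ es]
      · simp [succMark, hA, ← hA']
        rfl
      · exact fun t ht => hes t (by simp [ht])
      · exact hV
      · rfl
      · exact hA
      · rfl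
    · obtain ⟨b, i, j, hij, e⟩ := ih a (a' + 1)
        { s with T' := es.flatMap (fun t => List.replicate t TSym.tick ++ [TSym.entry]) ++ rest,
                 T := (List.replicate t TSym.tick ++ [TSym.entry]).reverse ++ s.T,
                 A := List.replicate a (),
                 A' := () :: s.A' } (fun t ht => hes t (by simp [ht])) hV rfl rfl
                 (by simp [hA', List.replicate_succ])
      refine ⟨b, i, j, by omega, ?_⟩
      rw [fetch_entry_skip v t s
        (es.flatMap (fun t => List.replicate t TSym.tick ++ [TSym.entry]) ++ rest)
        (hes t (by simp)) hV (by simp [h]) () (List.replicate a ())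
        (by rw [hA, List.replicate_succ]), e]
      simp [succMark]

theorem fetch_row (v : Reg) (es : List ℕ) (a : ℕ) (s : St) (rest : List TSym)
    (hes : ∀ t ∈ es, t ≤ s.V.length) (hV : s.V' = []) (h : s.T' = rowCode es ++ rest)
    (hA : s.A = List.replicate a ()) (hA' : s.A' = []) (hv : v.hit = false)
    (hc : v.cur = default) (u : Unit) (l : List Unit) (hK : s.K = u :: l) :
    fetch.eval ((v, default), s.get) = fetch.eval ((v, default),
      { s with T' := rest, T := (rowCode es).reverse ++ s.T, U := succMark s.V a es :: s.U,
               K := l }.get) := by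
  obtain ⟨b, i, j, hij, e⟩ := fetch_entries v es a 0 s (.row :: rest) hes hV
    (by simp [h, rowCode]) hA hA' hv hc
  rw [e, fetch, eval_loop_cons rfl rfl, ← fetch]
  cases v
  simp only at hv hc
  simp [eval, reset, flags, St.update_get, St.set, St.get, eval_restoreA, rowCode, hA, hA',
    show j + i = a by omega, hv, hc, hK]

theorem eval_fetch (v : Reg) (rows : List (List ℕ)) (a : ℕ) (s : St)
    (hes : ∀ es ∈ rows, ∀ t ∈ es, t ≤ s.V.length) (hV : s.V' = [])
    (h : s.T' = rows.flatMap rowCode)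
    (hA : s.A = List.replicate a ()) (hA' : s.A' = []) (hv : v.hit = false)
    (hc : v.cur = default) (hK : rows.length ≤ s.K.length) :
    fetch.eval ((v, default), s.get) = ((v, default),
      { s with T' := [], T := (rows.flatMap rowCode).reverse ++ s.T,
               U := (rows.map (succMark s.V a)).reverse ++ s.U,
               K := s.K.drop rows.length }.get) := by
  induction rows generalizing s with
  | nil =>
    rw [fetch, eval_loop_nil h]
    cases s
    simp_all
  | cons es rows ih =>
    obtain ⟨u, l, hl⟩ : ∃ u l, s.K = u :: l :=
      List.exists_cons_of_length_pos (by simp at hK; omega)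
    rw [fetch_row v es a s (rows.flatMap rowCode) (hes es (by simp)) hV (by simp [h]) hA hA' hv hc
      u l hl, ih]
    · simp [hl]
    · exact fun es h => hes es (by simp [h])
    · exact hV
    · rfl
    · exact hA
    · exact hA'
    · simpa [hl] using hK

/-! ### Reading a word -/

/-- Enter the mark of the successor state into a record. A splitting of the old word with a nonempty
second part is a splitting of the new word into two nonempty parts. -/
def enter (r : Rec) (m : Mark) : Rec :=
  { r with mark := ⟨m.acc, m.split, m.inner, m.inner⟩ }

/-- Enter the collected marks into the records that have been moved to the secondary stack. -/
def enterMarks : Prog :=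
  loop .U popMark
    (case .V' popRec (push .V (fun v => enter v.2.r v.2.m)) skip ;;
      push .K (fun _ => ()) ;; reset)

theorem eval_enterMarks (v : Reg) (us : List Mark) (rs : List Rec) (s : St)
    (hl : us.length = rs.length) (hU : s.U = us) (hV : s.V' = rs) :
    enterMarks.eval ((v, default), s.get) = ((v, default),
      { s with V := (List.zipWith enter rs us).reverse ++ s.V, V' := [], U := [],
               K := List.replicate us.length () ++ s.K }.get) := by
  induction us generalizing rs s with
  | nil =>
    rw [enterMarks, eval_loop_nil hU]
    have : rs = [] := List.length_eq_zero_iff.1 hl.symm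
    cases s
    simp_all
  | cons u us ih =>
    obtain ⟨r, rs, rfl⟩ : ∃ r l, rs = r :: l :=
      List.exists_cons_of_length_pos (by simp at hl; omega)
    rw [enterMarks, eval_loop_cons rfl hU, ← enterMarks]
    have := ih rs { s with U := us, V' := rs, V := enter r u :: s.V, K := () :: s.K }
      (by simpa using hl) rfl rfl
    simp [eval, reset, St.update_get, St.set, St.get, hV] at this ⊢
    rw [this, replicate_append_cons]

/-- Enter the collected marks into the records. -/
def merge : Prog := unwindV ;; enterMarks

theorem eval_merge (v : Reg) (s : St) (ms : List Mark) (hms : ms.length = s.V.length)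
    (hV : s.V' = []) (hU : s.U = ms.reverse) :
    merge.eval ((v, default), s.get) = ((v, default),
      { s with V := List.zipWith enter s.V ms, U := [],
               K := List.replicate ms.length () ++ s.K }.get) := by
  rw [merge, eval_seq, eval_unwindV, eval_enterMarks _ ms.reverse s.V.reverse]
  · simp only [hV, List.append_nil]
    rw [← List.reverse_zipWith hms.symm]
    simp
  · simp [hms]
  · exact hU
  · simp [hV]

/-- `P ⊆ {p | the word read so far is accepted from p}`, where `P` is the set of selected states. -/
def allAcc (vs : List Rec) : Bool := vs.all fun r => !r.sel || r.mark.acc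

/-- If all selected states accept the word read so far, this word splits from each of them, with an
empty first part. The second part is then nonempty if `b` holds. -/
def closeMarks (b : Bool) (vs : List Rec) : List Rec :=
  vs.map fun r =>
    { r with mark := { r.mark with split := r.mark.split || (r.sel && allAcc vs),
                                   inner := r.mark.inner || (r.sel && allAcc vs && b) } }

/-- The program for `closeMarks`. -/
def closeV (b : Bool) : Prog :=
  flags (fun v => { v with sub := true }) ;;
  transfer .V .V' (fun v r => { v with sub := v.sub && (!r.sel || r.mark.acc) })
    bufRec (fun _ u => u.r) ;;
  transfer .V' .V (fun v _ => v) bufRec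
    (fun v u => { u.r with mark := { u.r.mark with
      split := u.r.mark.split || (u.r.sel && v.sub),
      inner := u.r.mark.inner || (u.r.sel && v.sub && b) } }) ;;
  flags (fun v => { v with sub := false })

theorem eval_closeV (b : Bool) (v : Reg) (s : St) (hv : v.sub = false) (hV : s.V' = []) :
    (closeV b).eval ((v, default), s.get) =
      ((v, default), { s with V := closeMarks b s.V }.get) := by
  have hfold : ∀ (l : List Rec) (c : Bool),
      l.foldl (fun (v : Reg) r => { v with sub := v.sub && (!r.sel || r.mark.acc) })
        { v with sub := c } = { v with sub := c && allAcc l } := by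
    intro l
    induction l with
    | nil => intro c; simp [allAcc]
    | cons r l ih =>
      intro c
      rw [List.foldl_cons]
      refine (ih _).trans ?_
      simp [allAcc, Bool.and_assoc]
  rw [closeV, eval_seq, eval_flags, eval_seq,
    eval_transfer (k := .V) (k' := .V') (by decide) _ _ id (by intros; rfl),
    eval_seq, eval_transfer_map (by decide), eval_flags]
  cases v
  simp only at hv
  simp [St.set, St.get, hfold, hV, closeMarks, List.map_reverse, hv]

/-- The effect of reading the letter `a`, where `rows` is the transition table. -/
def readLetter (rows : List (List ℕ)) (vs : List Rec) (a : ℕ) : List Rec :=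
  closeMarks true (List.zipWith enter vs (rows.map (succMark vs a)))

/-- The list of numbers with a given unary code. An unfinished last number is ignored, and the
first number is increased by `c`. -/
def readNumbers : ℕ → List Bool → List ℕ
  | _, [] => []
  | c, true :: w => readNumbers (c + 1) w
  | c, false :: w => c :: readNumbers 0 w

/-- Between the letters of a word all auxiliary stacks and flags are clear, the stack `T` holds
the transition table `rows`, and the stack `K` is high enough. -/
structure Ready (rows : List (List ℕ)) (v : Reg) (s : St) : Prop where
  hit : v.hit = false
  cur : v.cur = default
  sub : v.sub = false
  V' : s.V' = []
  U : s.U = []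
  T : s.T = (rows.flatMap rowCode).reverse
  T' : s.T' = []
  A' : s.A' = []
  K : rows.length ≤ s.K.length
  length : rows.length = s.V.length
  le : ∀ es ∈ rows, ∀ t ∈ es, t ≤ s.V.length

theorem length_closeMarks (b : Bool) (vs : List Rec) : (closeMarks b vs).length = vs.length := by
  simp [closeMarks]

theorem length_readLetter (rows : List (List ℕ)) (vs : List Rec) (a : ℕ)
    (h : rows.length = vs.length) : (readLetter rows vs a).length = vs.length := by
  simp [readLetter, length_closeMarks, h]

/-- The program for `readLetter`. It also counts the letters. -/
def letter : Prog :=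
  case .N popUnit (push .N' fun _ => ()) (flags fun v => { v with long := true }) ;;
  moveT ;; fetch ;; merge ;; closeV true ;; clear .A

theorem eval_letter {rows : List (List ℕ)} {v : Reg} {s : St} (h : Ready rows v s) (a i j : ℕ)
    (hA : s.A = List.replicate a ()) (hN : s.N = List.replicate i ())
    (hN' : s.N' = List.replicate j ()) :
    ∃ i' j', i' + j' = i + j ∧ (1 ≤ i → i = i' + 1) ∧ (i = 0 → i' = 0) ∧
      letter.eval ((v, default), s.get) =
        (({ v with long := v.long || decide (i < 1) }, default),
          { s with V := readLetter rows s.V a, A := [], N := List.replicate i' (),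
                   N' := List.replicate j' () }.get) := by
  have key : ∀ (v : Reg) (s : St), Ready rows v s → s.A = List.replicate a () →
      (moveT ;; fetch ;; merge ;; closeV true ;; clear .A).eval ((v, default), s.get) =
        ((v, default), { s with V := readLetter rows s.V a, A := [] }.get) := by
    intro v s h hA
    rw [eval_seq, eval_moveT, eval_seq, eval_fetch v rows a, eval_seq,
      eval_merge _ _ (rows.map (succMark s.V a)), eval_seq, eval_closeV, eval_clear]
    · have hK : List.replicate rows.length () ++ s.K.drop rows.length = s.K := by
        rw [← replicate_length_unit (s.K.drop _), ← List.replicate_add, List.length_drop,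
          Nat.add_sub_cancel' h.K, replicate_length_unit]
      simp [St.set, readLetter, h.T, h.T', h.U, hK]
    · exact h.sub
    · exact h.V'
    · simp [h.length]
    · exact h.V'
    · simp [h.U]
    · exact h.le
    · exact h.V'
    · simp only [h.T, h.T', List.reverse_reverse, List.append_nil]
    · exact hA
    · exact h.A'
    · exact h.hit
    · exact h.cur
    · exact h.K
  rcases i with _ | i
  · refine ⟨0, j, rfl, by simp, by simp, ?_⟩
    have e : (case .N popUnit (push .N' fun _ => ())
        (flags fun v => { v with long := true }) : Prog).eval ((v, default), s.get) =
        (({ v with long := true }, default), s.get) := by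
      simp [eval, St.get, hN, flags]
    rw [letter, eval_seq, e, key { v with long := true } s
      ⟨h.hit, h.cur, h.sub, h.V', h.U, h.T, h.T', h.A', h.K, h.length,
      h.le⟩ hA]
    simp [← hN', hN]
  · refine ⟨i, j + 1, by omega, by simp, by simp, ?_⟩
    have e : (case .N popUnit (push .N' fun _ => ())
        (flags fun v => { v with long := true }) : Prog).eval ((v, default), s.get) =
        ((v, default), { s with N := List.replicate i (), N' := () :: s.N' }.get) := by
      simp [eval, St.get, hN, List.replicate_succ, St.update_get, St.set]
    rw [letter, eval_seq, e, key]
    · simp [hN', List.replicate_succ]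
    · exact ⟨h.hit, h.cur, h.sub, h.V', h.U, h.T, h.T', h.A', h.K, h.length, h.le⟩
    · exact hA

/-- Read the word on the stack `W`. -/
def readWord : Prog :=
  loop .W popBit (branch (fun v => v.2.b) (reset ;; push .A (fun _ => ())) (reset ;; letter))

theorem eval_readWord {rows : List (List ℕ)} (w : List Bool) (v : Reg) (s : St)
    (h : Ready rows v s) (c i j : ℕ) (hW : s.W = w) (hA : s.A = List.replicate c ())
    (hN : s.N = List.replicate i ()) (hN' : s.N' = List.replicate j ()) :
    ∃ c' i' j', i' + j' = i + j ∧
      readWord.eval ((v, default), s.get) =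
        (({ v with long := v.long || decide (i < (readNumbers c w).length) }, default),
          { s with W := [], V := (readNumbers c w).foldl (readLetter rows) s.V,
                   A := List.replicate c' (), N := List.replicate i' (),
                   N' := List.replicate j' () }.get) := by
  induction w generalizing v s c i j with
  | nil =>
    refine ⟨c, i, j, rfl, ?_⟩
    rw [readWord, eval_loop_nil hW]
    cases s
    simp_all [readNumbers]
  | cons b w ih =>
    cases b
    · obtain ⟨i₁, j₁, h₁, h₂, h₃, e⟩ := eval_letter (s := { s with W := w })
        ⟨h.hit, h.cur, h.sub, h.V', h.U, h.T, h.T', h.A', h.K, h.length, h.le⟩ c i j hA hN hN'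
      obtain ⟨c', i', j', h₄, e'⟩ := ih { v with long := v.long || decide (i < 1) }
        { s with W := w, V := readLetter rows s.V c, A := [], N := List.replicate i₁ (),
                 N' := List.replicate j₁ () }
        ⟨h.hit, h.cur, h.sub, h.V', h.U, h.T, h.T', h.A', h.K,
          by rw [length_readLetter _ _ _ h.length]; exact h.length,
          by rw [length_readLetter _ _ _ h.length]; exact h.le⟩ 0 i₁ j₁ rfl rfl rfl rfl
      refine ⟨c', i', j', by omega, ?_⟩
      rw [readWord, eval_loop_cons rfl hW, ← readWord]
      have e₀ : (branch (fun v => v.2.b) (reset ;; push .A (fun _ => ()))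
          (reset ;; letter) : Prog).eval
          (popBit (v, default) false, Function.update s.get .W w) =
          letter.eval ((v, default), { s with W := w }.get) := by
        rw [eval_branch, if_neg (by simp), eval_seq, popBit, eval_reset, St.update_get]
        simp only [St.set]
      refine (congrArg readWord.eval (e₀.trans e)).trans (e'.trans ?_)
      have : (decide (i < 1) || decide (i₁ < (readNumbers 0 w).length)) =
          decide (i < (readNumbers 0 w).length + 1) := by
        rw [← Bool.decide_or]
        apply decide_eq_decide.2
        omega
      simp only [readNumbers, Bool.or_assoc, this, List.foldl_cons, List.length_cons]
      rfl
    · obtain ⟨c', i', j', h₄, e'⟩ := ih v { s with W := w, A := List.replicate (c + 1) () }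
        ⟨h.hit, h.cur, h.sub, h.V', h.U, h.T, h.T', h.A', h.K, h.length, h.le⟩ (c + 1) i j rfl rfl
        hN hN'
      refine ⟨c', i', j', h₄, ?_⟩
      rw [readWord, eval_loop_cons rfl hW, ← readWord]
      have e₀ : (branch (fun v => v.2.b) (reset ;; push .A (fun _ => ()))
          (reset ;; letter) : Prog).eval
          (popBit (v, default) true, Function.update s.get .W w) =
          ((v, default), { s with W := w, A := () :: s.A }.get) := by
        rw [eval_branch, if_pos (by simp), eval_seq, popBit, eval_reset, St.update_get]
        simp [eval, St.update_get, St.set, St.get]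
      rw [hA, ← List.replicate_succ] at e₀
      refine (congrArg readWord.eval e₀).trans (e'.trans ?_)
      simp only [readNumbers]
      rfl

/-- The records for the empty word. -/
def initRecs (vs : List Rec) : List Rec :=
  closeMarks false (vs.map fun r => { r with mark := ⟨r.final, false, false, false⟩ })

/-- The mark of the initial state. -/
def startMark (m : Mark) (vs : List Rec) : Mark :=
  vs.foldl (fun m r => if r.start then r.mark else m) m

/-- Set up the records for the empty word and reset the counter of letters. -/
def initWord : Prog :=
  transfer .V .V' (fun v _ => v) bufRec
    (fun _ u => { u.r with mark := ⟨u.r.final, false, false, false⟩ }) ;;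
  rewindV ;; closeV false ;; restoreN ;; flags (fun v => { v with long := false })

/-- Read the word on the stack `W` and find out the mark of the initial state. -/
def runWord : Prog :=
  initWord ;; readWord ;; clear .A ;;
  transfer .V .V' (fun v r => { v with res := if r.start then r.mark else v.res }) bufRec
    (fun _ u => u.r) ;;
  rewindV

theorem eval_runWord {rows : List (List ℕ)} {v : Reg} {s : St} (h : Ready rows v s) (n : ℕ)
    (hA : s.A = []) (hN : s.N ++ s.N' = List.replicate n ()) :
    ∃ i j, i + j = n ∧
      runWord.eval ((v, default), s.get) =
        (({ v with
            long := decide (n < (readNumbers 0 s.W).length)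
            res := startMark v.res ((readNumbers 0 s.W).foldl (readLetter rows) (initRecs s.V)) },
          default),
          { s with W := [], V := (readNumbers 0 s.W).foldl (readLetter rows) (initRecs s.V),
                   N := List.replicate i (), N' := List.replicate j () }.get) := by
  have hl : (initRecs s.V).length = s.V.length := by simp [initRecs, length_closeMarks]
  have e : initWord.eval ((v, default), s.get) = (({ v with long := false }, default),
      { s with V := initRecs s.V, N := List.replicate n (), N' := [] }.get) := by
    have hN' : s.N' ++ s.N = List.replicate n () := by
      rw [← hN, ← reverse_unit (s.N ++ s.N'), List.reverse_append, reverse_unit, reverse_unit]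
    rw [initWord, eval_seq, eval_transfer_map (by decide), eval_seq, eval_rewindV, eval_seq]
    simp only [St.set, St.get]
    rw [eval_closeV _ _ _ h.sub rfl, eval_seq, eval_restoreN, eval_flags]
    simp [h.V', initRecs, hN']
  obtain ⟨c, i, j, hij, e'⟩ := eval_readWord (rows := rows) s.W { v with long := false }
    { s with V := initRecs s.V, N := List.replicate n (), N' := [] }
    ⟨h.hit, h.cur, h.sub, h.V', h.U, h.T, h.T', h.A', h.K, by rw [hl]; exact h.length,
      by rw [hl]; exact h.le⟩ 0 n 0 rfl hA rfl rfl
  have hfold : ∀ (l : List Rec) (v : Reg),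
      l.foldl (fun (v : Reg) r => { v with res := if r.start then r.mark else v.res }) v =
        { v with res := startMark v.res l } := by
    intro l
    induction l with
    | nil => intro v; rfl
    | cons r l ih =>
      intro v
      rw [List.foldl_cons, ih]
      rfl
  refine ⟨i, j, hij, ?_⟩
  rw [runWord, eval_seq, e, eval_seq, e', eval_seq, eval_clear, eval_seq,
    eval_transfer (k := .V) (k' := .V') (by decide) _ _ id (by intros; rfl), eval_rewindV]
  simp [St.set, St.get, hfold, h.V', ← hA]

/-! ### Parsing the automaton -/

/-- The unary code of a list of numbers. -/
def unary (l : List ℕ) : List Bool :=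
  l.flatMap fun m => List.replicate m true ++ [false]

/-- Record that the input is not the description of an automaton. -/
def fail : Prog := flags fun v => { v with err := true }

/-- Read a stroke of a number. -/
def onTick : Prog :=
  branch (fun v => v.1.phase = .states) (push .V (fun _ => default) ;; push .N (fun _ => ())) <|
  branch (fun v => v.1.phase = .letters) (push .K (fun _ => ())) <|
  branch (fun v => v.1.phase = .start) (advanceV fail) <|
  branch (fun v => v.1.phase = .head)
    (branch (fun v => v.1.fin) fail (flags fun v => { v with fin := true })) <|
  push .T (fun _ => .tick) ;; advanceV fail

/-- Go on to the next entry of the row or, if the row is complete, to the next row. -/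
def nextEntry : Prog :=
  case .K popUnit (push .K (fun _ => ()) ;; flags fun v => { v with phase := .entry })
    (push .T (fun _ => .row) ;; push .U (fun v => ⟨v.1.fin, false, false, false⟩) ;;
      flags (fun v => { v with phase := .head, fin := false }) ;; restoreK)

/-- Read the end of a number. -/
def onEnd : Prog :=
  branch (fun v => v.1.phase = .states) (flags fun v => { v with phase := .letters }) <|
  branch (fun v => v.1.phase = .letters) (flags fun v => { v with phase := .start }) <|
  branch (fun v => v.1.phase = .start)
    (case .V popRec (push .V (fun v => { v.2.r with start := true }) ;; reset ;; rewindV ;;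
      flags fun v => { v with phase := .head }) fail) <|
  branch (fun v => v.1.phase = .head)
    (case .N popUnit (push .N' (fun _ => ()) ;; nextEntry) fail) <|
  push .T (fun _ => .entry) ;; rewindV ;;
    case .K popUnit (push .K' (fun _ => ()) ;; nextEntry) fail

/-- Read the description of an automaton from the stack `X`. -/
def parse : Prog :=
  loop .X popBit <| branch (fun v => v.1.err) reset <|
    branch (fun v => v.2.b) (reset ;; onTick) (reset ;; onEnd)

theorem parse_nil (v : Reg × Buf) (s : St) (h : s.X = []) :
    parse.eval (v, s.get) = (v, s.get) :=
  eval_loop_nil h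

theorem parse_err (v : Reg) (s : St) (hv : v.err = true) :
    (parse.eval ((v, default), s.get)).1.1.err = true := by
  generalize h : s.X = w
  induction w generalizing s with
  | nil => rw [parse_nil _ _ h]; exact hv
  | cons b w ih =>
    rw [parse, eval_loop_cons rfl h, ← parse, eval_branch, if_pos (by simpa using hv), popBit,
      eval_reset, St.update_get]
    exact ih _ rfl

theorem parse_true (v : Reg) (s : St) (w : List Bool) (hv : v.err = false)
    (h : s.X = true :: w) :
    parse.eval ((v, default), s.get) =
      parse.eval (onTick.eval ((v, default), { s with X := w }.get)) := by
  rw [parse, eval_loop_cons rfl h, ← parse, eval_branch, if_neg (by simp [hv]), eval_branch,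
    if_pos (by simp), eval_seq, popBit, eval_reset, St.update_get]
  simp only [St.set]

theorem parse_false (v : Reg) (s : St) (w : List Bool) (hv : v.err = false)
    (h : s.X = false :: w) :
    parse.eval ((v, default), s.get) =
      parse.eval (onEnd.eval ((v, default), { s with X := w }.get)) := by
  rw [parse, eval_loop_cons rfl h, ← parse, eval_branch, if_neg (by simp [hv]), eval_branch,
    if_neg (by simp), eval_seq, popBit, eval_reset, St.update_get]
  simp only [St.set]

/-- Strokes do not change the phase, and a stroke that has been counted in `fin` remains. -/
theorem onTick_flags (v : Reg) (s : St) : ∃ (v' : Reg) (s' : St),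
    onTick.eval ((v, default), s.get) = ((v', default), s'.get) ∧ s'.X = s.X ∧ v'.phase = v.phase ∧ (v.fin = true → v'.fin = true) := by
  rcases h : v.phase
  · exact ⟨v, { s with V := default :: s.V, N := () :: s.N },
      by simp [onTick, eval, h, St.update_get, St.set, St.get], rfl, h, id⟩
  · exact ⟨v, { s with K := () :: s.K },
      by simp [onTick, eval, h, St.update_get, St.set, St.get], rfl, h, id⟩
  · rcases hV : s.V with _ | ⟨r, l⟩
    · exact ⟨{ v with err := true }, s,
        by simp [onTick, eval, h, St.get, advanceV, fail, flags, hV], rfl, h, id⟩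
    · exact ⟨v, { s with V := l, V' := r :: s.V' },
        by simp [onTick, eval, h, St.get, St.update_get, St.set, advanceV, reset, hV], rfl, h, id⟩
  · rcases hf : v.fin with _ | _
    · exact ⟨{ v with fin := true }, s, by simp [onTick, eval, h, flags, hf], rfl, h, fun _ => rfl⟩
    · exact ⟨{ v with err := true }, s, by simp [onTick, eval, h, flags, fail, hf], rfl, h,
        fun _ => hf⟩
  · rcases hV : s.V with _ | ⟨r, l⟩
    · exact ⟨{ v with err := true }, { s with T := .tick :: s.T },
        by simp [onTick, eval, h, St.get, St.update_get, St.set, advanceV, fail, flags, hV],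
        rfl, h, id⟩
    · exact ⟨v, { s with T := .tick :: s.T, V := l, V' := r :: s.V' },
        by simp [onTick, eval, h, St.get, St.update_get, St.set, advanceV, reset, hV], rfl, h, id⟩

theorem parse_ticks_flags (m : ℕ) (v : Reg) (s : St) (h : s.X = List.replicate m true) :
    (parse.eval ((v, default), s.get)).1.1.phase = v.phase ∧
      (v.fin = true → (parse.eval ((v, default), s.get)).1.1.fin = true) := by
  induction m generalizing v s with
  | zero => rw [parse_nil _ _ h]; exact ⟨rfl, id⟩
  | succ m ih =>
    rcases hv : v.err with _ | _
    · rw [parse_true _ _ _ hv h]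
      obtain ⟨v', s', e, h₁, h₂, h₃⟩ := onTick_flags v { s with X := List.replicate m true }
      rw [e]
      obtain ⟨h₄, h₅⟩ := ih v' s' h₁
      exact ⟨h₄.trans h₂, fun h => h₅ (h₃ h)⟩
    · have : ∀ (w : List Bool) (s : St), s.X = w →
          (parse.eval ((v, default), s.get)).1.1 = v := by
        intro w
        induction w with
        | nil => intro s h; rw [parse_nil _ _ h]
        | cons b w ih =>
          intro s h
          rw [parse, eval_loop_cons rfl h, ← parse, eval_branch, if_pos (by simpa using hv), popBit,
            eval_reset, St.update_get]
          exact ih _ rfl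
      rw [this _ _ rfl]
      exact ⟨rfl, id⟩

/-- The records before the rows are read: there are `n` states, and `q` is initial. -/
def startRecs (n q : ℕ) : List Rec :=
  List.replicate q default ++ { (default : Rec) with start := true } ::
    List.replicate (n - q - 1) default

theorem length_startRecs {n q : ℕ} (h : q < n) : (startRecs n q).length = n := by
  simp [startRecs]; omega

/-- The flags between two numbers of the table. -/
def tableReg (ph : Phase) (f : Bool) : Reg := { (default : Reg) with phase := ph, fin := f }

/-- The stacks after the rows `rows`, each with its acceptance bit, have been read. -/
def headSt (Y Z : List Bool) (n k q : ℕ) (rows : List (Bool × List ℕ)) (X : List Bool) : St :=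
  { St.empty with
    X := X
    Y := Y
    Z := Z
    T := (rows.flatMap fun r => rowCode r.2).reverse
    V := startRecs n q
    U := (rows.map fun r => (⟨r.1, false, false, false⟩ : Mark)).reverse
    N := List.replicate (n - rows.length) ()
    N' := List.replicate rows.length ()
    K := List.replicate k () }

/-- The stacks after the rows `rows`, and the entries `es` of the next row, have been read. -/
def entrySt (Y Z : List Bool) (n k q : ℕ) (rows : List (Bool × List ℕ)) (es : List ℕ)
    (X : List Bool) : St :=
  { St.empty with
    X := X
    Y := Y
    Z := Z
    T := ((rows.flatMap fun r => rowCode r.2) ++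
      es.flatMap fun t => List.replicate t TSym.tick ++ [TSym.entry]).reverse
    V := startRecs n q
    U := (rows.map fun r => (⟨r.1, false, false, false⟩ : Mark)).reverse
    N := List.replicate (n - (rows.length + 1)) ()
    N' := List.replicate (rows.length + 1) ()
    K := List.replicate (k - es.length) ()
    K' := List.replicate es.length () }

section Rows

variable (Y Z : List Bool) (n k q : ℕ)

/-- The state of the parser after the entries `es` of the current row, with acceptance bit `f`, have
been read. -/
def afterEntry (rows : List (Bool × List ℕ)) (f : Bool) (es : List ℕ) (X : List Bool) :
    (Reg × Buf) × (∀ k, List (Γ k)) :=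
  if es.length < k then ((tableReg .entry f, default), (entrySt Y Z n k q rows es X).get)
  else ((tableReg .head false, default), (headSt Y Z n k q (rows ++ [(f, es)]) X).get)

theorem eval_nextEntry (rows : List (Bool × List ℕ)) (f : Bool) (es : List ℕ) (X : List Bool)
    (ph : Phase) (hes : es.length ≤ k) :
    nextEntry.eval ((tableReg ph f, default), (entrySt Y Z n k q rows es X).get) =
      afterEntry Y Z n k q rows f es X := by
  unfold afterEntry
  split_ifs with h
  · obtain ⟨j, hj⟩ : ∃ j, k - es.length = j + 1 := ⟨k - es.length - 1, by omega⟩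
    simp [nextEntry, eval, entrySt, St.get, St.update_get, St.set, hj, List.replicate_succ, flags,
      tableReg]
  · have hj' : es.length = k := by omega
    simp [nextEntry, eval, entrySt, headSt, St.get, St.update_get, St.set, flags, tableReg,
      eval_restoreK, rowCode, hj', St.empty]

theorem parse_head_end (rows : List (Bool × List ℕ)) (f : Bool) (X : List Bool)
    (h : rows.length < n) :
    parse.eval ((tableReg .head f, default), (headSt Y Z n k q rows (false :: X)).get) =
      parse.eval (afterEntry Y Z n k q rows f [] X) := by
  rw [parse_false (tableReg .head f) (headSt Y Z n k q rows (false :: X)) X rfl rfl,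
    ← eval_nextEntry Y Z n k q rows f [] X .head (by simp)]
  congr 1
  obtain ⟨j, hj⟩ : ∃ j, n - rows.length = j + 1 := ⟨n - rows.length - 1, by omega⟩
  have hj' : n - (rows.length + 1) = j := by omega
  have e : (case .N popUnit (push .N' (fun _ => ()) ;; nextEntry) fail : Prog).eval
      ((tableReg .head f, default), (headSt Y Z n k q rows X).get) =
      nextEntry.eval ((tableReg .head f, default), (entrySt Y Z n k q rows [] X).get) := by
    simp [eval, headSt, entrySt, St.get, St.update_get, St.set, St.empty, hj, hj',
      List.replicate_succ]
  rw [← e]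
  rfl

theorem parse_head_overflow (rows : List (Bool × List ℕ)) (f : Bool) (X : List Bool)
    (h : n ≤ rows.length) :
    (parse.eval ((tableReg .head f, default),
      (headSt Y Z n k q rows (false :: X)).get)).1.1.err = true := by
  rw [parse_false (tableReg .head f) (headSt Y Z n k q rows (false :: X)) X rfl rfl]
  have : onEnd.eval ((tableReg .head f, default), (headSt Y Z n k q rows X).get) =
      (({ tableReg .head f with err := true }, default), (headSt Y Z n k q rows X).get) := by
    simp [onEnd, eval, headSt, St.get, tableReg, fail, flags, Nat.sub_eq_zero_of_le h]
  exact this ▸ parse_err _ _ rfl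

/-- The stacks while an entry of the current row is being read, `j` strokes of which have been
read. -/
def tickSt (rows : List (Bool × List ℕ)) (es : List ℕ) (j : ℕ) (X : List Bool) : St :=
  { entrySt Y Z n k q rows es X with
    T := List.replicate j TSym.tick ++ (entrySt Y Z n k q rows es X).T
    V := (startRecs n q).drop j
    V' := ((startRecs n q).take j).reverse }

theorem tickSt_zero (rows : List (Bool × List ℕ)) (es : List ℕ) (X : List Bool) :
    tickSt Y Z n k q rows es 0 X = entrySt Y Z n k q rows es X := by
  simp [tickSt, entrySt, St.empty]

variable {q n}

theorem parse_entry_tick (hq : q < n) (rows : List (Bool × List ℕ)) (f : Bool) (es : List ℕ)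
    (j : ℕ) (X : List Bool) (hj : j < n) :
    parse.eval ((tableReg .entry f, default), (tickSt Y Z n k q rows es j (true :: X)).get) =
      parse.eval ((tableReg .entry f, default), (tickSt Y Z n k q rows es (j + 1) X).get) := by
  rw [parse_true (tableReg .entry f) (tickSt Y Z n k q rows es j (true :: X)) X rfl rfl]
  congr 1
  have hl := length_startRecs hq
  have h₁ : (startRecs n q).drop j = (startRecs n q)[j] :: (startRecs n q).drop (j + 1) :=
    List.drop_eq_getElem_cons (by omega)
  have h₂ : ((startRecs n q).take (j + 1)).reverse =
      (startRecs n q)[j] :: ((startRecs n q).take j).reverse := by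
    rw [List.take_add_one, List.getElem?_eq_getElem (by omega)]
    simp
  generalize (startRecs n q)[j] = r at h₁ h₂
  generalize hd : (startRecs n q).drop (j + 1) = l at h₁
  simp [onTick, eval, tableReg, tickSt, entrySt, St.get, St.update_get, St.set, advanceV, reset,
    h₁, h₂, hd, List.replicate_succ]

theorem parse_entry_overflow (hq : q < n) (rows : List (Bool × List ℕ)) (f : Bool) (es : List ℕ)
    (X : List Bool) :
    (parse.eval ((tableReg .entry f, default),
      (tickSt Y Z n k q rows es n (true :: X)).get)).1.1.err = true := by
  rw [parse_true (tableReg .entry f) (tickSt Y Z n k q rows es n (true :: X)) X rfl rfl]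
  have hl : (startRecs n q).drop n = [] :=
    List.drop_eq_nil_of_le (length_startRecs hq).le
  have hl' : (startRecs n q).drop (n + 1) = [] :=
    List.drop_eq_nil_of_le (by rw [length_startRecs hq]; omega)
  have ht : (startRecs n q).take n = (startRecs n q).take (n + 1) := by
    rw [List.take_of_length_le (length_startRecs hq).le,
      List.take_of_length_le (by rw [length_startRecs hq]; omega)]
  have : onTick.eval ((tableReg .entry f, default), (tickSt Y Z n k q rows es n X).get) =
      (({ tableReg .entry f with err := true }, default),
        (tickSt Y Z n k q rows es (n + 1) X).get) := by
    simp [onTick, eval, tableReg, tickSt, entrySt, St.get, St.update_get, St.set, advanceV, fail,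
      flags, List.replicate_succ, hl, hl', ht]
  exact this ▸ parse_err _ _ rfl

theorem parse_entry_end (rows : List (Bool × List ℕ)) (f : Bool) (es : List ℕ)
    (j : ℕ) (X : List Bool) (hk : es.length < k) :
    parse.eval ((tableReg .entry f, default), (tickSt Y Z n k q rows es j (false :: X)).get) =
      parse.eval (afterEntry Y Z n k q rows f (es ++ [j]) X) := by
  rw [parse_false (tableReg .entry f) (tickSt Y Z n k q rows es j (false :: X)) X rfl rfl,
    ← eval_nextEntry Y Z n k q rows f (es ++ [j]) X .entry (by simp; omega)]
  congr 1
  obtain ⟨i, hi⟩ : ∃ i, k - es.length = i + 1 := ⟨k - es.length - 1, by omega⟩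
  have hi' : k - (es.length + 1) = i := by omega
  have e : (push .T (fun _ => .entry) ;; rewindV ;;
      case .K popUnit (push .K' (fun _ => ()) ;; nextEntry) fail : Prog).eval
      ((tableReg .entry f, default), (tickSt Y Z n k q rows es j X).get) =
      nextEntry.eval ((tableReg .entry f, default), (entrySt Y Z n k q rows (es ++ [j]) X).get) := by
    simp [eval, eval_rewindV, tickSt, entrySt, St.get, St.update_get, St.set, hi, hi',
      List.replicate_succ, St.empty]
  rw [← e]
  rfl

/-- An entry that is at most the number of states is read correctly, and a larger one is
rejected. -/
theorem parse_entry (hq : q < n) (rows : List (Bool × List ℕ)) (f : Bool) (es : List ℕ)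
    (m : ℕ) (X : List Bool) (hk : es.length < k) :
    (m ≤ n → parse.eval ((tableReg .entry f, default),
        (entrySt Y Z n k q rows es (List.replicate m true ++ false :: X)).get) =
      parse.eval (afterEntry Y Z n k q rows f (es ++ [m]) X)) ∧
    (n < m → (parse.eval ((tableReg .entry f, default),
        (entrySt Y Z n k q rows es (List.replicate m true ++ false :: X)).get)).1.1.err = true) := by
  have ticks : ∀ j i X, j + i ≤ n →
      parse.eval ((tableReg .entry f, default),
        (tickSt Y Z n k q rows es j (List.replicate i true ++ X)).get) =
      parse.eval ((tableReg .entry f, default), (tickSt Y Z n k q rows es (j + i) X).get) := by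
    intro j i
    induction i generalizing j with
    | zero => intro X _; rfl
    | succ i ih =>
      intro X h
      rw [List.replicate_succ, List.cons_append, parse_entry_tick Y Z k hq _ _ _ _ _ (by omega),
        ih _ _ (by omega)]
      congr 4
      omega
  constructor
  · intro h
    rw [← tickSt_zero, ticks 0 m _ (by omega), parse_entry_end Y Z k _ _ _ _ _ hk]
    simp
  · intro h
    obtain ⟨i, rfl⟩ : ∃ i, m = n + (i + 1) := ⟨m - n - 1, by omega⟩
    rw [← tickSt_zero, List.replicate_add, List.append_assoc, ticks 0 n _ (by omega), zero_add,
      List.replicate_succ, List.cons_append]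
    exact parse_entry_overflow Y Z k hq _ _ _ _

/-- The first number of a row is read correctly if it is `0` or `1` and a further row is due; it is
rejected otherwise. -/
theorem parse_head (rows : List (Bool × List ℕ)) (m : ℕ) (X : List Bool) :
    (rows.length < n → ∀ f : Bool, m = f.toNat → parse.eval ((tableReg .head false, default),
        (headSt Y Z n k q rows (List.replicate m true ++ false :: X)).get) =
      parse.eval (afterEntry Y Z n k q rows f [] X)) ∧
    (n ≤ rows.length ∨ 1 < m → (parse.eval ((tableReg .head false, default),
        (headSt Y Z n k q rows (List.replicate m true ++ false :: X)).get)).1.1.err = true) := by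
  have tick : ∀ X, parse.eval ((tableReg .head false, default),
        (headSt Y Z n k q rows (true :: X)).get) =
      parse.eval ((tableReg .head true, default), (headSt Y Z n k q rows X).get) := by
    intro X
    rw [parse_true (tableReg .head false) (headSt Y Z n k q rows (true :: X)) X rfl rfl]
    rfl
  constructor
  · rintro h f rfl
    cases f
    · exact parse_head_end Y Z n k q rows false X h
    · refine (tick _).trans ?_
      exact parse_head_end Y Z n k q rows true X h
  · intro h
    rcases m with _ | _ | m
    · exact parse_head_overflow Y Z n k q rows false X (by omega)
    · refine (congrArg (fun s => s.1.1.err) (tick _)).trans ?_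
      exact parse_head_overflow Y Z n k q rows true X (by omega)
    · rw [List.replicate_succ, List.cons_append, tick, List.replicate_succ, List.cons_append,
        parse_true (tableReg .head true) (headSt Y Z n k q rows _) _ rfl rfl]
      have : ∀ X, onTick.eval ((tableReg .head true, default), (headSt Y Z n k q rows X).get) =
          (({ tableReg .head true with err := true }, default),
            (headSt Y Z n k q rows X).get) := fun X => rfl
      exact (this _) ▸ parse_err _ _ rfl

/-- The numbers in the description of a row. -/
def rowNumbers (r : Bool × List ℕ) : List ℕ := r.1.toNat :: r.2

theorem unary_cons (m : ℕ) (l : List ℕ) (X : List Bool) :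
    unary (m :: l) ++ X = List.replicate m true ++ false :: (unary l ++ X) := by
  simp [unary]

/-- The rows have the right number of entries, and all entries are at most the number of states. -/
def ValidRows (n k : ℕ) (rows : List (Bool × List ℕ)) : Prop :=
  ∀ r ∈ rows, r.2.length = k ∧ ∀ t ∈ r.2, t ≤ n

theorem parse_entries (hq : q < n) (rows : List (Bool × List ℕ)) (f : Bool) (es es' : List ℕ)
    (X : List Bool) (hk : (es ++ es').length = k) (h : ∀ t ∈ es', t ≤ n) :
    parse.eval (afterEntry Y Z n k q rows f es (unary es' ++ X)) =
      parse.eval ((tableReg .head false, default),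
        (headSt Y Z n k q (rows ++ [(f, es ++ es')]) X).get) := by
  induction es' generalizing es with
  | nil =>
    rw [List.append_nil] at hk
    rw [afterEntry, if_neg (by omega)]
    simp [unary]
  | cons t es' ih =>
    rw [List.length_append, List.length_cons] at hk
    rw [afterEntry, if_pos (by omega), unary_cons,
      (parse_entry Y Z k hq rows f es t _ (by omega)).1 (h t (by simp)),
      ih _ (by simp; omega) (fun t ht => h t (by simp [ht]))]
    simp

/-- Valid rows are read correctly. -/
theorem parse_rows (hq : q < n) (rows rows' : List (Bool × List ℕ)) (X : List Bool)
    (hn : (rows ++ rows').length ≤ n) (h : ValidRows n k rows') :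
    parse.eval ((tableReg .head false, default),
        (headSt Y Z n k q rows (unary (rows'.flatMap rowNumbers) ++ X)).get) =
      parse.eval ((tableReg .head false, default), (headSt Y Z n k q (rows ++ rows') X).get) := by
  induction rows' generalizing rows with
  | nil => simp [unary]
  | cons r rows' ih =>
    rw [List.length_append, List.length_cons] at hn
    obtain ⟨hr, hr'⟩ := h r (by simp)
    have e : unary ((r :: rows').flatMap rowNumbers) ++ X =
        List.replicate r.1.toNat true ++ false ::
          (unary r.2 ++ (unary (rows'.flatMap rowNumbers) ++ X)) := by
      simp [unary, rowNumbers]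
    rw [e, (parse_head Y Z k rows _ _).1 (by omega) r.1 rfl,
      parse_entries Y Z k hq rows r.1 [] r.2 _ (by simpa using hr) hr', List.nil_append,
      ih _ (by simp; omega) fun r hr => h r (by simp [hr])]
    simp

/-- The parser has ended in a state in which the description is complete. -/
def Complete (c : (Reg × Buf) × (∀ k, List (Γ k))) : Prop :=
  c.1.1.err = false ∧ c.1.1.phase = .head ∧ c.1.1.fin = false ∧ c.2 .N = []

theorem not_complete_of_err {c : (Reg × Buf) × (∀ k, List (Γ k))} (h : c.1.1.err = true) :
    ¬ Complete c := by
  simp [Complete, h]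

/-- If the parser accepts, the input consists of valid rows. -/
theorem rows_of_complete (hq : q < n) (r : ℕ) (l : List ℕ) :
    (∀ rows, ValidRows n k rows → rows.length ≤ n →
      Complete (parse.eval ((tableReg .head false, default),
        (headSt Y Z n k q rows (unary l ++ List.replicate r true)).get)) →
      r = 0 ∧ ∃ rows', ValidRows n k rows' ∧ rows'.length = n ∧
        rows'.flatMap rowNumbers = rows.flatMap rowNumbers ++ l) ∧
    (∀ rows f es, ValidRows n k rows → rows.length < n → es.length ≤ k → (∀ t ∈ es, t ≤ n) →
      Complete (parse.eval (afterEntry Y Z n k q rows f es (unary l ++ List.replicate r true))) →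
      r = 0 ∧ ∃ rows', ValidRows n k rows' ∧ rows'.length = n ∧
        rows'.flatMap rowNumbers = rows.flatMap rowNumbers ++ (f.toNat :: es) ++ l) := by
  have full : ∀ {rows : List (Bool × List ℕ)} {f es}, ValidRows n k rows → es.length = k →
      (∀ t ∈ es, t ≤ n) → ValidRows n k (rows ++ [(f, es)]) := by
    intro rows f es h h₁ h₂ r hr
    rcases List.mem_append.1 hr with hr | hr
    · exact h r hr
    · rw [List.mem_singleton] at hr
      subst hr
      exact ⟨h₁, h₂⟩
  -- A complete row leads back to the first case.
  have step : ∀ l, (∀ rows, ValidRows n k rows → rows.length ≤ n →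
      Complete (parse.eval ((tableReg .head false, default),
        (headSt Y Z n k q rows (unary l ++ List.replicate r true)).get)) →
      r = 0 ∧ ∃ rows', ValidRows n k rows' ∧ rows'.length = n ∧
        rows'.flatMap rowNumbers = rows.flatMap rowNumbers ++ l) →
      ∀ rows f es, ValidRows n k rows → rows.length < n → es.length = k → (∀ t ∈ es, t ≤ n) →
      Complete (parse.eval (afterEntry Y Z n k q rows f es (unary l ++ List.replicate r true))) →
      r = 0 ∧ ∃ rows', ValidRows n k rows' ∧ rows'.length = n ∧
        rows'.flatMap rowNumbers = rows.flatMap rowNumbers ++ (f.toNat :: es) ++ l := by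
    intro l ih rows f es h h₁ h₂ h₃ hc
    rw [afterEntry, if_neg (by omega)] at hc
    obtain ⟨h₄, rows', h₅, h₆, h₇⟩ := ih _ (full h h₂ h₃) (by simp; omega) hc
    refine ⟨h₄, rows', h₅, h₆, ?_⟩
    simpa [rowNumbers] using h₇
  induction l with
  | nil =>
    have head : ∀ rows, ValidRows n k rows → rows.length ≤ n →
        Complete (parse.eval ((tableReg .head false, default),
          (headSt Y Z n k q rows (unary [] ++ List.replicate r true)).get)) →
        r = 0 ∧ ∃ rows', ValidRows n k rows' ∧ rows'.length = n ∧
          rows'.flatMap rowNumbers = rows.flatMap rowNumbers ++ [] := by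
      intro rows h h₁ hc
      rcases r with _ | r
      · rw [parse_nil _ _ (by simp [unary, headSt])] at hc
        obtain ⟨-, -, -, hN⟩ := hc
        refine ⟨rfl, rows, h, ?_, by simp⟩
        simp [headSt, St.get] at hN
        omega
      · exfalso
        have e : parse.eval ((tableReg .head false, default),
              (headSt Y Z n k q rows (unary [] ++ List.replicate (r + 1) true)).get) =
            parse.eval ((tableReg .head true, default),
              (headSt Y Z n k q rows (List.replicate r true)).get) :=
          parse_true (tableReg .head false)
            (headSt Y Z n k q rows (true :: List.replicate r true)) _ rfl rfl
        rw [e] at hc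
        have := (parse_ticks_flags r (tableReg .head true)
          (headSt Y Z n k q rows (List.replicate r true)) rfl).2 rfl
        rw [hc.2.2.1] at this
        exact Bool.noConfusion this
    refine ⟨head, fun rows f es h h₁ h₂ h₃ hc => ?_⟩
    rcases h₂.lt_or_eq with h₂ | h₂
    · exfalso
      rw [afterEntry, if_pos h₂] at hc
      have := (parse_ticks_flags r (tableReg .entry f)
        (entrySt Y Z n k q rows es (List.replicate r true)) rfl).1
      exact Phase.noConfusion (hc.2.1.symm.trans this)
    · exact step _ head rows f es h h₁ h₂ h₃ hc
  | cons m l ih =>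
    have head : ∀ rows, ValidRows n k rows → rows.length ≤ n →
        Complete (parse.eval ((tableReg .head false, default),
          (headSt Y Z n k q rows (unary (m :: l) ++ List.replicate r true)).get)) →
        r = 0 ∧ ∃ rows', ValidRows n k rows' ∧ rows'.length = n ∧
          rows'.flatMap rowNumbers = rows.flatMap rowNumbers ++ m :: l := by
      intro rows h h₁ hc
      rw [unary_cons] at hc
      obtain ⟨h₂, h₃⟩ := parse_head (q := q) (n := n) Y Z k rows m
        (unary l ++ List.replicate r true)
      by_cases h₄ : n ≤ rows.length ∨ 1 < m
      · exact absurd hc (not_complete_of_err (h₃ h₄))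
      · obtain ⟨f, rfl⟩ : ∃ f : Bool, m = f.toNat := by
          rcases m with _ | _ | m
          · exact ⟨false, rfl⟩
          · exact ⟨true, rfl⟩
          · omega
        rw [h₂ (by omega) f rfl] at hc
        simpa using ih.2 rows f [] h (by omega) (by simp) (by simp) hc
    refine ⟨head, fun rows f es h h₁ h₂ h₃ hc => ?_⟩
    rcases h₂.lt_or_eq with h₂ | h₂
    · rw [afterEntry, if_pos h₂, unary_cons] at hc
      obtain ⟨h₄, h₅⟩ := parse_entry Y Z k hq rows f es m (unary l ++ List.replicate r true) h₂
      rcases le_or_gt m n with hm | hm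
      · rw [h₄ hm] at hc
        have h₆ : ∀ t ∈ es ++ [m], t ≤ n := by
          intro t ht
          rcases List.mem_append.1 ht with ht | ht
          · exact h₃ t ht
          · rw [List.mem_singleton.1 ht]; exact hm
        simpa using ih.2 rows f (es ++ [m]) h h₁ (by simp; omega) h₆ hc
      · exact absurd hc (not_complete_of_err (h₅ hm))
    · exact step _ head rows f es h h₁ h₂ h₃ hc

end Rows

section Start

variable (Y Z : List Bool)

/-- The stacks before anything has been read. -/
def inputSt (X : List Bool) : St := { St.empty with X := X, Y := Y, Z := Z }

/-- The stacks while the number of states is being read. -/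
def statesSt (i : ℕ) (X : List Bool) : St :=
  { inputSt Y Z X with V := List.replicate i default, N := List.replicate i () }

/-- The stacks while the number of letters is being read. -/
def lettersSt (n i : ℕ) (X : List Bool) : St :=
  { statesSt Y Z n X with K := List.replicate i () }

/-- The stacks while the initial state is being read. -/
def startSt (n k i : ℕ) (X : List Bool) : St :=
  { lettersSt Y Z n k X with V := List.replicate (n - i) default, V' := List.replicate i default }

theorem parse_states (i m : ℕ) (X : List Bool) :
    parse.eval ((default, default), (statesSt Y Z i (List.replicate m true ++ X)).get) =
      parse.eval ((default, default), (statesSt Y Z (i + m) X).get) := by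
  induction m generalizing i with
  | zero => rfl
  | succ m ih =>
    rw [List.replicate_succ, List.cons_append, parse_true default (statesSt Y Z i _) _ rfl rfl,
      show i + (m + 1) = (i + 1) + m by omega, ← ih]
    congr 1
    have h : (default : Reg).phase = .states := rfl
    simp [onTick, eval, h, St.update_get, St.set, St.get, statesSt, inputSt, List.replicate_succ]

theorem parse_letters (n i m : ℕ) (X : List Bool) :
    parse.eval ((tableReg .letters false, default),
        (lettersSt Y Z n i (List.replicate m true ++ X)).get) =
      parse.eval ((tableReg .letters false, default), (lettersSt Y Z n (i + m) X).get) := by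
  induction m generalizing i with
  | zero => rfl
  | succ m ih =>
    rw [List.replicate_succ, List.cons_append,
      parse_true (tableReg .letters false) (lettersSt Y Z n i _) _ rfl rfl,
      show i + (m + 1) = (i + 1) + m by omega, ← ih]
    congr 1
    simp [onTick, eval, St.update_get, tableReg, St.set, St.get, lettersSt, statesSt, inputSt,
      List.replicate_succ]

theorem parse_start (n k i m : ℕ) (X : List Bool) :
    (i + m ≤ n → parse.eval ((tableReg .start false, default),
        (startSt Y Z n k i (List.replicate m true ++ X)).get) =
      parse.eval ((tableReg .start false, default), (startSt Y Z n k (i + m) X).get)) ∧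
    (i ≤ n → n < i + m → (parse.eval ((tableReg .start false, default),
        (startSt Y Z n k i (List.replicate m true ++ X)).get)).1.1.err = true) := by
  induction m generalizing i with
  | zero => exact ⟨fun _ => rfl, fun _ _ => by omega⟩
  | succ m ih =>
    rw [List.replicate_succ, List.cons_append,
      parse_true (tableReg .start false) (startSt Y Z n k i _) _ rfl rfl]
    rcases lt_or_ge i n with h | h
    · have e : onTick.eval ((tableReg .start false, default),
          (startSt Y Z n k i (List.replicate m true ++ X)).get) =
          ((tableReg .start false, default),
            (startSt Y Z n k (i + 1) (List.replicate m true ++ X)).get) := by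
        obtain ⟨j, hj⟩ : ∃ j, n - i = j + 1 := ⟨n - i - 1, by omega⟩
        have hj' : n - (i + 1) = j := by omega
        simp [onTick, eval, St.update_get, tableReg, St.set, St.get, startSt, lettersSt, statesSt,
          inputSt, List.replicate_succ, advanceV, hj, hj', reset]
      have e' := congrArg parse.eval e
      rw [show i + (m + 1) = (i + 1) + m by omega]
      exact ⟨fun h => e'.trans ((ih (i + 1)).1 h),
        fun _ h' => (congrArg (fun s => s.1.1.err) e').trans ((ih (i + 1)).2 h h')⟩
    · refine ⟨fun h => by omega, fun _ _ => ?_⟩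
      have : onTick.eval ((tableReg .start false, default),
          (startSt Y Z n k i (List.replicate m true ++ X)).get) =
          (({ tableReg .start false with err := true }, default),
            (startSt Y Z n k i (List.replicate m true ++ X)).get) := by
        simp [onTick, eval, tableReg, St.get, startSt, advanceV, fail, flags,
          Nat.sub_eq_zero_of_le h]
      exact this ▸ parse_err _ _ rfl

theorem parse_start_end (n k q : ℕ) (X : List Bool) :
    (q < n → parse.eval ((tableReg .start false, default), (startSt Y Z n k q (false :: X)).get) =
      parse.eval ((tableReg .head false, default), (headSt Y Z n k q [] X).get)) ∧
    (q = n → (parse.eval ((tableReg .start false, default),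
      (startSt Y Z n k q (false :: X)).get)).1.1.err = true) := by
  rw [parse_false (tableReg .start false) (startSt Y Z n k q _) _ rfl rfl]
  constructor
  · intro h
    obtain ⟨j, hj⟩ : ∃ j, n - q = j + 1 := ⟨n - q - 1, by omega⟩
    congr 1
    simp [onEnd, eval, St.update_get, tableReg, St.set, St.get, startSt, lettersSt, statesSt,
      inputSt, List.replicate_succ, hj, reset, flags, eval_rewindV, headSt, startRecs, St.empty]
  · rintro rfl
    have : onEnd.eval ((tableReg .start false, default), (startSt Y Z q k q X).get) =
        (({ tableReg .start false with err := true }, default), (startSt Y Z q k q X).get) := by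
      simp [onEnd, eval, tableReg, St.get, startSt, fail, flags]
    exact this ▸ parse_err _ _ rfl

/-- The numbers of states and letters and the initial state are read correctly. -/
theorem parse_numbers (n k q : ℕ) (X : List Bool) :
    (q < n → parse.eval ((default, default), (inputSt Y Z (unary [n, k, q] ++ X)).get) =
      parse.eval ((tableReg .head false, default), (headSt Y Z n k q [] X).get)) ∧
    (n ≤ q → (parse.eval ((default, default),
      (inputSt Y Z (unary [n, k, q] ++ X)).get)).1.1.err = true) := by
  have e : parse.eval ((default, default), (inputSt Y Z (unary [n, k, q] ++ X)).get) =
      parse.eval ((tableReg .start false, default),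
        (startSt Y Z n k 0 (List.replicate q true ++ false :: X)).get) := by
    rw [unary_cons, unary_cons, unary_cons]
    refine (parse_states Y Z 0 n _).trans ?_
    rw [zero_add, parse_false default (statesSt Y Z n _) _ rfl rfl]
    refine (parse_letters Y Z n 0 k (false :: (List.replicate q true ++ false :: X))).trans ?_
    rw [zero_add, parse_false (tableReg .letters false) (lettersSt Y Z n k _) _ rfl rfl]
    rfl
  rw [e]
  constructor
  · intro h
    rw [(parse_start Y Z n k 0 q _).1 (by omega), zero_add, (parse_start_end Y Z n k q X).1 h]
  · intro h
    rcases h.eq_or_lt with h | h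
    · rw [(parse_start Y Z n k 0 q _).1 (by omega), zero_add]
      exact (parse_start_end Y Z n k q X).2 h.symm
    · exact (parse_start Y Z n k 0 q _).2 (by omega) (by omega)

theorem exists_unary (X : List Bool) : ∃ l r, X = unary l ++ List.replicate r true := by
  induction X with
  | nil => exact ⟨[], 0, rfl⟩
  | cons b X ih =>
    obtain ⟨l, r, rfl⟩ := ih
    cases b
    · exact ⟨0 :: l, r, by simp [unary]⟩
    · rcases l with _ | ⟨m, l⟩
      · exact ⟨[], r + 1, by simp [unary, List.replicate_succ]⟩
      · exact ⟨(m + 1) :: l, r, by simp [unary, List.replicate_succ]⟩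

/-- The strings that describe an automaton with `n` states, `k` letters, the initial state `q` and
the given rows. -/
def Describes (X : List Bool) (n k q : ℕ) (rows : List (Bool × List ℕ)) : Prop :=
  q < n ∧ ValidRows n k rows ∧ rows.length = n ∧ X = unary (n :: k :: q :: rows.flatMap rowNumbers)

theorem parse_of_describes {X : List Bool} {n k q : ℕ} {rows : List (Bool × List ℕ)}
    (h : Describes X n k q rows) :
    parse.eval ((default, default), (inputSt Y Z X).get) =
      ((tableReg .head false, default), (headSt Y Z n k q rows []).get) := by
  obtain ⟨hq, h₁, h₂, rfl⟩ := h
  have e : unary (n :: k :: q :: rows.flatMap rowNumbers) =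
      unary [n, k, q] ++ (unary (rows.flatMap rowNumbers) ++ []) := by
    simp [unary]
  rw [e, (parse_numbers Y Z n k q _).1 hq, parse_rows Y Z k hq [] rows [] (by simp [h₂]) h₁,
    List.nil_append]
  exact parse_nil _ _ rfl

theorem describes_of_complete {X : List Bool}
    (h : Complete (parse.eval ((default, default), (inputSt Y Z X).get))) :
    ∃ n k q rows, Describes X n k q rows := by
  obtain ⟨l, r, rfl⟩ := exists_unary X
  have aux : ∀ (v : Reg) (s : St), v.phase ≠ .head → s.X = List.replicate r true →
      ¬ Complete (parse.eval ((v, default), s.get)) := fun v s hv hs hc =>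
    hv ((parse_ticks_flags r v s hs).1.symm.trans hc.2.1)
  rcases l with _ | ⟨n, _ | ⟨k, _ | ⟨q, l⟩⟩⟩
  · exact absurd h (aux _ _ Phase.noConfusion rfl)
  · rw [unary_cons] at h
    have e := (parse_states Y Z 0 n (false :: (unary [] ++ List.replicate r true))).trans
      (parse_false default (statesSt Y Z (0 + n) _) _ rfl rfl)
    exact absurd (Eq.mp (congrArg Complete e) h)
      (aux (tableReg .letters false) (statesSt Y Z (0 + n) _) (by simp [tableReg]) rfl)
  · rw [unary_cons, unary_cons] at h
    have e := (parse_states Y Z 0 n _).trans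
      ((parse_false default (statesSt Y Z (0 + n) _) _ rfl rfl).trans
        ((parse_letters Y Z (0 + n) 0 k (false :: (unary [] ++ List.replicate r true))).trans
          (parse_false (tableReg .letters false) (lettersSt Y Z (0 + n) (0 + k) _) _ rfl rfl)))
    exact absurd (Eq.mp (congrArg Complete e) h)
      (aux (tableReg .start false) (lettersSt Y Z (0 + n) (0 + k) _) (by simp [tableReg]) rfl)
  · have e : unary (n :: k :: q :: l) ++ List.replicate r true =
        unary [n, k, q] ++ (unary l ++ List.replicate r true) := by
      simp [unary]
    rw [e] at h
    rcases lt_or_ge q n with hq | hq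
    · rw [(parse_numbers Y Z n k q _).1 hq] at h
      obtain ⟨rfl, rows, h₁, h₂, h₃⟩ :=
        (rows_of_complete Y Z k hq r l).1 [] (by simp [ValidRows]) (by simp) h
      exact ⟨n, k, q, rows, hq, h₁, h₂, by simp [h₃]⟩
    · exact absurd h (not_complete_of_err ((parse_numbers Y Z n k q _).2 hq))

end Start

/-! ### The main program -/

/-- Distribute the three components of the input to the stacks `W`, `Y`, `Z`. -/
def distribute : Prog :=
  loop .inp popInp
    (branch (fun v => v.2.i.isLeft)
      (push .W (fun v => v.2.i.elim id fun _ => false))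
      (branch (fun v => v.2.i.elim (fun _ => false) Sum.isLeft)
        (push .Y (fun v => v.2.i.elim id (Sum.elim id fun _ => false)))
        (push .Z (fun v => v.2.i.elim id (Sum.elim (fun _ => false) id)))) ;;
      reset)

/-- Distribute the input to the stacks `X`, `Y`, `Z`; the string on `X` is read from its beginning,
the others from their ends. -/
def unpack : Prog :=
  distribute ;; transfer .W .X (fun v _ => v) bufBit (fun _ u => u.b)

theorem eval_unpack (x y z : List Bool) :
    unpack.eval ((default, default), { St.empty with inp := tripleEncoding.encode (x, y, z) }.get) =
      ((default, default), (inputSt y.reverse z.reverse x).get) := by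
  have hZ : ∀ (z : List Bool) (s : St), s.inp = z.map (fun b => .inr (.inr b)) →
      distribute.eval ((default, default), s.get) =
        ((default, default), { s with inp := [], Z := z.reverse ++ s.Z }.get) := by
    intro z
    induction z with
    | nil =>
      intro s h
      rw [distribute, eval_loop_nil h]
      cases s
      simp_all
    | cons b z ih =>
      intro s h
      rw [distribute, eval_loop_cons rfl h, ← distribute]
      have e := ih { s with inp := z.map (fun b => .inr (.inr b)), Z := b :: s.Z } rfl
      simp only [List.reverse_cons, List.append_assoc, List.singleton_append]
      rw [← e]
      congr 1
      simp [eval, St.update_get, St.set, St.get, reset]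
  have hY : ∀ (y : List Bool) rest (s : St), s.inp = y.map (fun b => .inr (.inl b)) ++ rest →
      distribute.eval ((default, default), s.get) =
        distribute.eval
        ((default, default), { s with inp := rest, Y := y.reverse ++ s.Y }.get) := by
    intro y rest
    induction y with
    | nil =>
      intro s h
      cases s
      simp_all
    | cons b y ih =>
      intro s h
      rw [distribute, eval_loop_cons rfl h, ← distribute]
      have e := ih { s with inp := y.map (fun b => .inr (.inl b)) ++ rest, Y := b :: s.Y } rfl
      simp only [List.reverse_cons, List.append_assoc, List.singleton_append]
      rw [← e]
      congr 1
      simp [eval, St.update_get, St.set, St.get, reset]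
  have hX : ∀ (x : List Bool) rest (s : St), s.inp = x.map .inl ++ rest →
      distribute.eval ((default, default), s.get) =
        distribute.eval
        ((default, default), { s with inp := rest, W := x.reverse ++ s.W }.get) := by
    intro x rest
    induction x with
    | nil =>
      intro s h
      cases s
      simp_all
    | cons b x ih =>
      intro s h
      rw [distribute, eval_loop_cons rfl h, ← distribute]
      have e := ih { s with inp := x.map .inl ++ rest, W := b :: s.W } rfl
      simp only [List.reverse_cons, List.append_assoc, List.singleton_append]
      rw [← e]
      congr 1
      simp [eval, St.update_get, St.set, St.get, reset]
  have hxyz : tripleEncoding.encode (x, y, z) = x.map .inl ++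
      (y.map (fun b => .inr (.inl b)) ++ z.map (fun b => .inr (.inr b))) := by
    simp [tripleEncoding, encodingProd, encodingList, Function.comp_def]
  rw [unpack, eval_seq, hX x _ _ hxyz, hY y _ _ rfl, hZ z _ rfl, eval_transfer_map (by decide)]
  simp [St.set, St.get, inputSt, St.empty]

/-- Select states according to a list of bits; no state is selected once the bits are used up.
The mark entered in a record says whether the state is accepting. -/
def selectRecs : List Rec → List Bool → List Rec
  | [], _ => []
  | r :: vs, bs =>
    { r with final := r.mark.acc, sel := bs.headD false } :: selectRecs vs bs.tail

theorem length_selectRecs (vs : List Rec) (bs : List Bool) :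
    (selectRecs vs bs).length = vs.length := by
  induction vs generalizing bs with
  | nil => rfl
  | cons r vs ih => simp [selectRecs, ih]

/-- The program for `selectRecs`, where the bits are taken from the stack `Y`. -/
def select : Prog :=
  loop .V popRec
    (case .Y popBit
      (push .V' fun v => { v.2.r with final := v.2.r.mark.acc, sel := v.2.b })
      (push .V' fun v => { v.2.r with final := v.2.r.mark.acc, sel := false }) ;;
    reset) ;;
  rewindV

theorem eval_select (v : Reg) (s : St) (hV : s.V' = []) :
    select.eval ((v, default), s.get) = ((v, default),
      { s with V := selectRecs s.V s.Y, Y := s.Y.drop s.V.length }.get) := by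
  have key : ∀ vs (s : St), s.V = vs → (loop .V popRec
      (case .Y popBit
        (push .V' fun v => { v.2.r with final := v.2.r.mark.acc, sel := v.2.b })
        (push .V' fun v => { v.2.r with final := v.2.r.mark.acc, sel := false }) ;;
        reset) : Prog).eval ((v, default), s.get) = ((v, default),
      { s with V := [], V' := (selectRecs vs s.Y).reverse ++ s.V',
               Y := s.Y.drop vs.length }.get) := by
    intro vs
    induction vs with
    | nil =>
      intro s h
      rw [eval_loop_nil h]
      cases s
      simp_all [selectRecs]
    | cons r vs ih =>
      intro s h
      rw [eval_loop_cons rfl h]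
      have e := ih { s with
        V := vs
        Y := s.Y.tail
        V' := { r with final := r.mark.acc, sel := s.Y.headD false } :: s.V' } rfl
      have hd : s.Y.drop (vs.length + 1) = s.Y.tail.drop vs.length := by
        cases s.Y <;> simp
      simp only [selectRecs, List.reverse_cons, List.append_assoc, List.singleton_append,
        List.length_cons, hd]
      rw [← e]
      congr 1
      rcases hY : s.Y with _ | ⟨b, bs⟩ <;>
        simp [eval, St.update_get, St.set, St.get, reset, hY]
  rw [select, eval_seq, key _ _ rfl, eval_rewindV]
  simp [hV]

/-- The records of the states of an automaton with initial state `q` and the given rows, where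
the selected states are given by a list of bits. -/
def tableRecs (n q : ℕ) (rows : List (Bool × List ℕ)) (bs : List Bool) : List Rec :=
  selectRecs (List.zipWith enter (startRecs n q) (rows.map fun r => ⟨r.1, false, false, false⟩)) bs

/-- After the automaton has been read, complete the records of the states and put the word that
remains on the stack `Y` onto the stack `W`. -/
def setup : Prog :=
  merge ;; select ;; transfer .Y .W (fun v _ => v) bufBit (fun _ u => u.b)

theorem eval_setup (Y Z : List Bool) {n k q : ℕ} (hq : q < n) (rows : List (Bool × List ℕ))
    (hn : rows.length = n) :
    setup.eval ((tableReg .head false, default), (headSt Y Z n k q rows []).get) =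
      ((tableReg .head false, default), { headSt Y Z n k q rows [] with
        V := tableRecs n q rows Y
        U := []
        Y := []
        W := (Y.drop n).reverse
        K := List.replicate (n + k) () }.get) := by
  have hl : (headSt Y Z n k q rows []).V.length = n := length_startRecs hq
  rw [setup, eval_seq, eval_merge _ _ (rows.map fun r => ⟨r.1, false, false, false⟩), eval_seq,
    eval_select, eval_transfer_map (by decide)]
  · simp [St.set, St.get, headSt, tableRecs, hn, length_startRecs hq, St.empty]
  · rfl
  · simp [hl, hn]
  · rfl
  · rfl

/-- The mark of the initial state for a word, where `vs` are the records of the states. -/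
def wordMark (rows : List (List ℕ)) (vs : List Rec) (w : List ℕ) : Mark :=
  startMark default (w.foldl (readLetter rows) (initRecs vs))

/-- Read the word on the stack `W` and then the word on the stack `Z`. -/
def runWords : Prog :=
  runWord ;; flags (fun v => { v with res' := v.res, long' := v.long, res := default }) ;;
  transfer .Z .W (fun v _ => v) bufBit (fun _ u => u.b) ;; runWord

/-- The records for the empty word do not depend on the present marks. -/
theorem initRecs_congr {vs vs' : List Rec}
    (h : vs.map (fun r => { r with mark := default }) =
      vs'.map fun r => { r with mark := default }) :
    initRecs vs = initRecs vs' := by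
  have e : ∀ vs : List Rec, vs.map (fun r => { r with mark := ⟨r.final, false, false, false⟩ }) =
      (vs.map (fun r => { r with mark := default })).map
        fun r => { r with mark := ⟨r.final, false, false, false⟩ } := fun vs => by simp
  rw [initRecs, initRecs, e, e vs', h]

theorem map_closeMarks (b : Bool) (vs : List Rec) :
    (closeMarks b vs).map (fun r => { r with mark := default }) =
      vs.map fun r => { r with mark := default } := by
  simp [closeMarks]

theorem map_readLetter (rows : List (List ℕ)) (vs : List Rec) (a : ℕ)
    (h : rows.length = vs.length) :
    (readLetter rows vs a).map (fun r => { r with mark := default }) =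
      vs.map fun r => { r with mark := default } := by
  rw [readLetter, map_closeMarks]
  exact List.ext_getElem (by simp [h]) fun i h₁ h₂ => by simp [enter]

theorem length_foldl_readLetter (rows : List (List ℕ)) (vs : List Rec) (w : List ℕ)
    (h : rows.length = vs.length) : (w.foldl (readLetter rows) vs).length = vs.length := by
  induction w generalizing vs with
  | nil => rfl
  | cons a w ih =>
    have := length_readLetter rows vs a h
    rw [List.foldl_cons, ih _ (h.trans this.symm), this]

theorem initRecs_foldl (rows : List (List ℕ)) (vs : List Rec) (w : List ℕ)
    (h : rows.length = vs.length) :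
    initRecs (w.foldl (readLetter rows) (initRecs vs)) = initRecs vs := by
  apply initRecs_congr
  have hfold : ∀ vs : List Rec, rows.length = vs.length →
      (w.foldl (readLetter rows) vs).map (fun r => { r with mark := default }) =
        vs.map fun r => { r with mark := default } := by
    intro vs h
    induction w generalizing vs with
    | nil => rfl
    | cons a w ih =>
      rw [List.foldl_cons, ih _ (h.trans (length_readLetter rows vs a h).symm),
        map_readLetter _ _ _ h]
  rw [hfold _ (by simpa [initRecs, length_closeMarks] using h), initRecs, map_closeMarks]
  simp

theorem eval_runWords {rows : List (List ℕ)} {v : Reg} {s : St} (h : Ready rows v s) (n : ℕ)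
    (hA : s.A = []) (hN : s.N ++ s.N' = List.replicate n ()) (hv : v.res = default) :
    ∃ s' : St, runWords.eval ((v, default), s.get) =
      (({ v with
          res' := wordMark rows s.V (readNumbers 0 s.W)
          long' := decide (n < (readNumbers 0 s.W).length)
          res := wordMark rows s.V (readNumbers 0 s.Z.reverse)
          long := decide (n < (readNumbers 0 s.Z.reverse).length) }, default), s'.get) := by
  obtain ⟨i, j, hij, e⟩ := eval_runWord h n hA hN
  have hl : (initRecs s.V).length = s.V.length := by simp [initRecs, length_closeMarks]
  have hl' := length_foldl_readLetter rows (initRecs s.V) (readNumbers 0 s.W)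
    (by rw [hl]; exact h.length)
  obtain ⟨i', j', hij', e'⟩ := eval_runWord (rows := rows)
    (v := { v with
      res' := startMark v.res ((readNumbers 0 s.W).foldl (readLetter rows) (initRecs s.V))
      long' := decide (n < (readNumbers 0 s.W).length)
      long := decide (n < (readNumbers 0 s.W).length)
      res := default })
    (s := { s with
      W := s.Z.reverse
      Z := []
      V := (readNumbers 0 s.W).foldl (readLetter rows) (initRecs s.V)
      N := List.replicate i ()
      N' := List.replicate j () })
    ⟨h.hit, h.cur, h.sub, h.V', h.U, h.T, h.T', h.A', h.K, by rw [hl', hl]; exact h.length,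
      by rw [hl', hl]; exact h.le⟩ n hA (by rw [← List.replicate_add, hij])
  rw [runWords, eval_seq, e, eval_seq, eval_flags, eval_seq, eval_transfer_map (by decide)]
  simp only [St.set, St.get, List.append_nil]
  have hZ : (s.Z.map fun a => (bufBit a).b) = s.Z := by simp
  rw [hZ]
  simp only [initRecs_foldl _ _ _ h.length, hv] at e' ⊢
  exact ⟨_, e'⟩

/-- Halt with the answer in the flag `ans`. -/
def finish : Prog :=
  clear .inp ;; clear .out ;; clear .X ;; clear .Y ;; clear .Z ;; clear .W ;; clear .T ;;
    clear .T' ;; clear .V ;; clear .V' ;; clear .U ;; clear .N ;; clear .N' ;; clear .K ;;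
    clear .K' ;; clear .A ;; clear .A' ;; push .out (fun v => v.1.ans) ;;
    load fun _ => (default, default)

theorem exists_get (S : ∀ k, List (Γ k)) : ∃ s : St, s.get = S :=
  ⟨⟨S .inp, S .out, S .X, S .Y, S .Z, S .W, S .T, S .T', S .V, S .V', S .U, S .N, S .N', S .K,
    S .K', S .A, S .A'⟩, by funext k; cases k <;> rfl⟩

theorem get_single (k : Stk) (l : List (Γ k)) : single k l = (St.empty.set k l).get := by
  rw [← St.update_get, single]
  congr 1
  funext k
  cases k <;> rfl

theorem eval_finish (v : Reg × Buf) (S : ∀ k, List (Γ k)) :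
    finish.eval (v, S) = ((default, default), single .out [v.1.ans]) := by
  obtain ⟨s, rfl⟩ := exists_get S
  simp only [finish, eval_seq, eval_clear]
  simp only [eval, St.update_get, get_single]
  rfl

/-- The input is the description of an automaton. -/
def accepted (v : Reg) : Bool := !v.err && decide (v.phase = .head) && !v.fin

/-- Read the input and, if the first component is the description of an automaton, run it on the
words given by the other components; the answer is `verdict` applied to the mark for the first
word, whether that word has more letters than there are states, and the same data for the second
word. The answer is `bad` if the first component is not the description of an automaton. -/
def answer (verdict : Mark → Bool → Mark → Bool → Bool) (bad : Bool) : Prog :=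
  unpack ;; parse ;; case .N popUnit fail skip ;;
  branch (fun v => accepted v.1)
    (setup ;; runWords ;; flags fun v => { v with ans := verdict v.res' v.long' v.res v.long })
    (flags fun v => { v with ans := bad })

/-- The relation that is decided by the program. -/
def relation (verdict : Mark → Bool → Mark → Bool → Bool) (bad : Bool)
    (t : List Bool × List Bool × List Bool) : Bool :=
  ((answer verdict bad).eval
    ((default, default), { St.empty with inp := tripleEncoding.encode t }.get)).1.1.ans

/-- Weights for the stacks such that the program is disciplined. A bit of the automaton has to
pay for up to three symbols, namely two markers of the table and a mark at the end of a row. -/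
def weight : Stk → ℕ
  | .inp | .X | .Y | .Z | .W => 3
  | _ => 1

theorem polyTimeDecidable_relation (verdict : Mark → Bool → Mark → Bool → Bool) (bad : Bool) :
    PolyTimeDecidable (relation verdict bad) := by
  refine tm2ComputableInPolyTime (answer verdict bad ;; finish) .inp .out (default, default)
    (Equiv.refl _) (Equiv.refl _) (w := weight) rfl fun t => ?_
  have h := eval_finish ((answer verdict bad).eval
    ((default, default), { St.empty with inp := tripleEncoding.encode t }.get)).1
    ((answer verdict bad).eval
    ((default, default), { St.empty with inp := tripleEncoding.encode t }.get)).2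
  rw [eval_seq, get_single]
  simp only [Equiv.refl_symm, Equiv.coe_refl, List.map_id]
  exact h

theorem relation_of_describes {verdict : Mark → Bool → Mark → Bool → Bool} {bad : Bool}
    {x : List Bool} {n k q : ℕ} {rows : List (Bool × List ℕ)} (h : Describes x n k q rows)
    (y z : List Bool) :
    relation verdict bad (x, y, z) =
      verdict
        (wordMark (rows.map Prod.snd) (tableRecs n q rows y.reverse)
          (readNumbers 0 (y.reverse.drop n).reverse))
        (decide (n < (readNumbers 0 (y.reverse.drop n).reverse).length))
        (wordMark (rows.map Prod.snd) (tableRecs n q rows y.reverse) (readNumbers 0 z))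
        (decide (n < (readNumbers 0 z).length)) := by
  have hlen : (tableRecs n q rows y.reverse).length = n := by
    simp [tableRecs, length_selectRecs, length_startRecs h.1, h.2.2.1]
  obtain ⟨s', e⟩ := eval_runWords (rows := rows.map Prod.snd) (v := tableReg .head false)
    (s := { headSt y.reverse z.reverse n k q rows [] with
        V := tableRecs n q rows y.reverse
        U := []
        Y := []
        W := (y.reverse.drop n).reverse
        K := List.replicate (n + k) () })
    ⟨rfl, rfl, rfl, rfl, rfl, by simp [headSt, List.flatMap_map], rfl, rfl,
      by simp [h.2.2.1], by simp [hlen, h.2.2.1], by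
        simp only [hlen]
        rintro es hes t ht
        obtain ⟨r, hr, rfl⟩ := List.mem_map.1 hes
        exact (h.2.1 r hr).2 t ht⟩ n rfl (by simp [headSt, h.2.2.1]) rfl
  have hN : (case .N popUnit fail skip : Prog).eval ((tableReg .head false, default),
      (headSt y.reverse z.reverse n k q rows []).get) = ((tableReg .head false, default),
      (headSt y.reverse z.reverse n k q rows []).get) := by
    simp [eval, St.get, headSt, h.2.2.1, skip]
  rw [relation, answer, eval_seq, eval_unpack, eval_seq, parse_of_describes _ _ h, eval_seq, hN,
    eval_branch, if_pos (show accepted (tableReg .head false) = true from rfl), eval_seq,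
    eval_setup _ _ h.1 _ h.2.2.1, eval_seq, e, eval_flags]
  simp [headSt]

theorem relation_of_not_describes {verdict : Mark → Bool → Mark → Bool → Bool} {bad : Bool}
    {x : List Bool} (h : ∀ n k q rows, ¬ Describes x n k q rows) (y z : List Bool) :
    relation verdict bad (x, y, z) = bad := by
  rw [relation, answer, eval_seq, eval_unpack, eval_seq, eval_seq, eval_branch]
  have hc : ¬ Complete (parse.eval ((default, default), (inputSt y.reverse z.reverse x).get)) :=
    fun hc => by
      obtain ⟨n, k, q, rows, hd⟩ := describes_of_complete _ _ hc
      exact h n k q rows hd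
  generalize parse.eval ((default, default), (inputSt y.reverse z.reverse x).get) = c at hc
  rw [if_neg]
  · rfl
  · rcases hN : c.2 .N with _ | ⟨u, l⟩
    · intro ha
      apply hc
      simp [eval, hN, skip, accepted] at ha
      exact ⟨ha.1.1, ha.1.2, ha.2, hN⟩
    · simp [eval, hN, fail, flags, accepted]

end PrimalityTest

/-! ### Finite and decomposable languages of automata -/

namespace PartialDFA

variable (M : PartialDFA)

/-- The automaton as a total automaton whose letters are all numbers: `none` is a sink, to which all
missing transitions lead, and so do all numbers that are not letters. -/
def total : DFA ℕ (Option (Fin M.states)) where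
  step o a := o.bind fun q => if h : a < M.letters then M.step q ⟨a, h⟩ else none
  start := some M.start
  accept := {o | ∃ q ∈ M.accept, o = some q}

/-- The word `w` is accepted from the state `o`. -/
def Acc (o : Option (Fin M.states)) (w : List ℕ) : Prop :=
  M.total.evalFrom o w ∈ M.total.accept

variable {M}

theorem evalFrom_none (w : List ℕ) : M.total.evalFrom none w = none := by
  induction w with
  | nil => rfl
  | cons a w ih => exact ih

theorem exists_map_val {o : Option (Fin M.states)} {q : Fin M.states} {w : List ℕ}
    (h : M.total.evalFrom o w = some q) : ∃ u : List (Fin M.letters), u.map Fin.val = w := by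
  induction w generalizing o with
  | nil => exact ⟨[], rfl⟩
  | cons a w ih =>
    obtain ⟨u, rfl⟩ := ih (o := M.total.step o a) h
    by_cases ha : a < M.letters
    · exact ⟨⟨a, ha⟩ :: u, rfl⟩
    · have : M.total.step o a = none := by
        cases o <;> simp [total, ha]
      rw [DFA.evalFrom_cons, this, evalFrom_none] at h
      simp at h

theorem Acc.exists_map_val {o : Option (Fin M.states)} {w : List ℕ} (h : M.Acc o w) :
    ∃ u : List (Fin M.letters), u.map Fin.val = w := by
  obtain ⟨q, -, hq⟩ := h
  exact PartialDFA.exists_map_val hq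

theorem mem_language_iff {u : List (Fin M.letters)} :
    u ∈ M.language ↔ M.Acc (some M.start) (u.map Fin.val) := by
  have key : ∀ (u : List (Fin M.letters)) (o : Option (Fin M.states)),
      M.toNFA.evalFrom {q | o = some q} u = {q | M.total.evalFrom o (u.map Fin.val) = some q} := by
    intro u
    induction u with
    | nil => intro o; rfl
    | cons a u ih =>
      intro o
      rw [NFA.evalFrom_cons, List.map_cons, DFA.evalFrom_cons, ← ih]
      congr 1
      ext q
      cases o <;> simp [toNFA, total]
  have h : M.toNFA.eval u = {q | M.total.evalFrom (some M.start) (u.map Fin.val) = some q} := by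
    have : M.toNFA.start = {q | some M.start = some q} := by
      ext q
      simp [toNFA, eq_comm]
    rw [← key, ← this, NFA.eval]
  rw [language, NFA.mem_accepts, ← NFA.eval, h]
  simp [Acc, total, toNFA]

/-- The language is infinite if it contains a word with more letters than there are states. -/
theorem infinite_of_acc {w : List ℕ} (h : M.Acc (some M.start) w) (hw : M.states < w.length) :
    ¬ Set.Finite (M.language : Set (List (Fin M.letters))) := by
  intro hfin
  obtain ⟨a, b, c, -, -, hb, habc⟩ := M.total.pumping_lemma (x := w) h (by simpa using hw)
  -- The lengths of the accepted words are bounded.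
  obtain ⟨B, hB⟩ := (hfin.image List.length).bddAbove
  have hmem : a ++ (List.replicate (B + 1) b).flatten ++ c ∈ M.total.accepts := by
    apply habc
    refine Language.append_mem_mul (Language.append_mem_mul rfl ?_) rfl
    exact Language.mem_kstar.2 ⟨_, rfl, fun y hy => List.eq_of_mem_replicate hy⟩
  obtain ⟨u, hu⟩ := Acc.exists_map_val (o := some M.start) hmem
  have hlen := hB ⟨u, mem_language_iff.2 (by rw [hu]; exact hmem), rfl⟩
  have hb' := List.length_pos_of_ne_nil hb
  have := congrArg List.length hu
  simp only [List.length_map, List.length_append, List.length_flatten, List.map_replicate,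
    List.sum_replicate, smul_eq_mul] at this
  nlinarith

/-- If the language is infinite, a shortest one among its words with more letters than there are
states is not much longer than that. -/
theorem exists_acc_of_infinite (h : ¬ Set.Finite (M.language : Set (List (Fin M.letters)))) :
    ∃ w, M.Acc (some M.start) w ∧ M.states < w.length ∧ w.length ≤ 2 * M.states + 1 := by
  have hex : ∃ w, M.Acc (some M.start) w ∧ M.states < w.length := by
    by_contra! hall
    refine h ((List.finite_length_le (Fin M.letters) M.states).subset fun u hu => ?_)
    simpa using hall _ (mem_language_iff.1 hu)
  obtain ⟨w, hw, hmin⟩ : ∃ w, (M.Acc (some M.start) w ∧ M.states < w.length) ∧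
      ∀ w', M.Acc (some M.start) w' ∧ M.states < w'.length → w.length ≤ w'.length := by
    obtain ⟨w, hw, hm⟩ := WellFounded.has_min (measure (List.length (α := ℕ))).wf
      {w | M.Acc (some M.start) w ∧ M.states < w.length} hex
    exact ⟨w, hw, fun w' hw' => not_lt.1 (hm w' hw')⟩
  refine ⟨w, hw.1, hw.2, ?_⟩
  -- Otherwise, pumping down gives a shorter word.
  by_contra! hlong
  obtain ⟨a, b, c, rfl, hab, hb, habc⟩ := M.total.pumping_lemma (x := w) hw.1 (by simpa using hw.2)
  have hmem : a ++ [] ++ c ∈ M.total.accepts :=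
    habc (Language.append_mem_mul (Language.append_mem_mul rfl (Language.nil_mem_kstar _)) rfl)
  have hb' := List.length_pos_of_ne_nil hb
  simp only [Fintype.card_option, Fintype.card_fin] at hab
  have := hmin _ ⟨hmem, by simp at hlong ⊢; omega⟩
  simp only [List.append_nil, List.length_append] at this hlong
  omega

variable (P : Fin M.states → Bool)

/-- The word `w` is accepted from all states in `P`. -/
def AllAcc (w : List ℕ) : Prop :=
  ∀ q, P q = true → M.Acc (some q) w

/-- The word `u ++ v` splits from the state `o` into `u` and `v`: the word `u` leads from `o` to a
state in `P`, and `v` is accepted from all states in `P`. -/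
def SplitsInto (o : Option (Fin M.states)) (u v : List ℕ) : Prop :=
  (∃ q, M.total.evalFrom o u = some q ∧ P q = true) ∧ AllAcc P v

/-- The word `w` splits from the state `o`. -/
def Splits (o : Option (Fin M.states)) (w : List ℕ) : Prop :=
  ∃ u v, w = u ++ v ∧ SplitsInto P o u v

/-- The word `w` splits from the state `o` with a nonempty second part. -/
def SplitsInner (o : Option (Fin M.states)) (w : List ℕ) : Prop :=
  ∃ u v, w = u ++ v ∧ v ≠ [] ∧ SplitsInto P o u v

/-- The word `w` splits from the state `o` into two nonempty parts. -/
def SplitsStrictly (o : Option (Fin M.states)) (w : List ℕ) : Prop :=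
  ∃ u v, w = u ++ v ∧ u ≠ [] ∧ v ≠ [] ∧ SplitsInto P o u v

variable {P}

theorem SplitsInto.acc {o : Option (Fin M.states)} {u v : List ℕ} (h : SplitsInto P o u v) :
    M.Acc o (u ++ v) := by
  obtain ⟨⟨q, hq, hP⟩, hv⟩ := h
  rw [Acc, DFA.evalFrom_of_append, hq]
  exact hv q hP

theorem SplitsStrictly.acc {o : Option (Fin M.states)} {w : List ℕ} (h : SplitsStrictly P o w) :
    M.Acc o w := by
  obtain ⟨u, v, rfl, -, -, h⟩ := h
  exact h.acc

variable (M)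

/-- The language is decomposable if and only if there are a set `P` of states from which all words
of the language split, and one word that splits into two nonempty parts (unless the language is
empty). -/
theorem isDecomposable_iff : M.language.IsDecomposable ↔
    ∃ (P : Fin M.states → Bool) (w₀ : List ℕ), ∀ w, M.Acc (some M.start) w →
      Splits P (some M.start) w ∧ SplitsStrictly P (some M.start) w₀ := by
  classical
  constructor
  · rintro ⟨L₁, L₂, h₁, h₂, h⟩
    let P : Fin M.states → Bool := fun q =>
      decide (∃ u ∈ L₁, M.total.evalFrom (some M.start) (u.map Fin.val) = some q)
    have hP : ∀ u ∈ L₁, ∀ v ∈ L₂, SplitsInto P (some M.start) (u.map Fin.val) (v.map Fin.val) := by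
      intro u hu v hv
      constructor
      · have : M.Acc (some M.start) ((u ++ v).map Fin.val) :=
          mem_language_iff.1 (h ▸ Language.append_mem_mul hu hv)
        rw [Acc, List.map_append, DFA.evalFrom_of_append] at this
        rcases hq : M.total.evalFrom (some M.start) (u.map Fin.val) with _ | q
        · rw [hq, evalFrom_none] at this
          obtain ⟨q, -, hq⟩ := this
          simp at hq
        · exact ⟨q, rfl, decide_eq_true ⟨u, hu, hq⟩⟩
      · intro q hq
        obtain ⟨u', hu', hq'⟩ := of_decide_eq_true hq
        have : M.Acc (some M.start) ((u' ++ v).map Fin.val) :=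
          mem_language_iff.1 (h ▸ Language.append_mem_mul hu' hv)
        rwa [Acc, List.map_append, DFA.evalFrom_of_append, hq'] at this
    -- A nonempty language other than `{ε}` contains a nonempty word.
    have hne : ∀ {L : Language (Fin M.letters)} {u}, L ≠ 1 → u ∈ L → ∃ u ∈ L, u ≠ [] := by
      intro L u hL hu
      by_contra! hall
      refine hL (Set.ext fun v => ⟨fun hv => hall v hv, ?_⟩)
      rintro rfl
      rwa [← hall u hu]
    by_cases hL : ∃ u, u ∈ M.language
    · obtain ⟨u, hu⟩ := hL
      rw [h] at hu
      obtain ⟨a, ha, b, hb, -⟩ := Language.mem_mul.1 hu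
      obtain ⟨a, ha, ha'⟩ := hne h₁ ha
      obtain ⟨b, hb, hb'⟩ := hne h₂ hb
      refine ⟨P, a.map Fin.val ++ b.map Fin.val, fun w hw => ⟨?_, ?_⟩⟩
      · obtain ⟨w, rfl⟩ := hw.exists_map_val
        have hw' := mem_language_iff.2 hw
        rw [h] at hw'
        obtain ⟨u, hu, v, hv, rfl⟩ := Language.mem_mul.1 hw'
        exact ⟨_, _, List.map_append, hP u hu v hv⟩
      · exact ⟨_, _, rfl, by simpa using ha', by simpa using hb', hP a ha b hb⟩
    · refine ⟨P, [], fun w hw => absurd ?_ hL⟩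
      obtain ⟨w, rfl⟩ := hw.exists_map_val
      exact ⟨w, mem_language_iff.2 hw⟩
  · rintro ⟨P, w₀, h⟩
    by_cases hL : ∃ u, u ∈ M.language
    · obtain ⟨u, hu⟩ := hL
      obtain ⟨u₀, v₀, -, hu₀, hv₀, ⟨q, hq, hPq⟩, hv⟩ := (h _ (mem_language_iff.1 hu)).2
      let L₁ : Language (Fin M.letters) :=
        {u | ∃ q, M.total.evalFrom (some M.start) (u.map Fin.val) = some q ∧ P q = true}
      let L₂ : Language (Fin M.letters) := {v | AllAcc P (v.map Fin.val)}
      refine ⟨L₁, L₂, ?_, ?_, ?_⟩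
      · obtain ⟨u₁, rfl⟩ := exists_map_val hq
        intro e
        have : u₁ ∈ (1 : Language (Fin M.letters)) := e ▸ ⟨q, hq, hPq⟩
        rw [Language.mem_one] at this
        exact hu₀ (by simp [this])
      · obtain ⟨v₁, rfl⟩ := (hv q hPq).exists_map_val
        intro e
        have : v₁ ∈ (1 : Language (Fin M.letters)) := e ▸ hv
        rw [Language.mem_one] at this
        exact hv₀ (by simp [this])
      · ext w
        rw [Language.mem_mul]
        constructor
        · intro hw
          obtain ⟨u, v, e, hu, hv⟩ := (h _ (mem_language_iff.1 hw)).1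
          obtain ⟨u, v, rfl, rfl, rfl⟩ := List.map_eq_append_iff.1 e
          exact ⟨u, hu, v, hv, rfl⟩
        · rintro ⟨u, hu, v, hv, rfl⟩
          rw [mem_language_iff, List.map_append]
          exact SplitsInto.acc ⟨hu, hv⟩
    · refine ⟨0, 0, ?_, ?_, ?_⟩
      · exact fun e => Language.notMem_zero [] (e ▸ Language.nil_mem_one)
      · exact fun e => Language.notMem_zero [] (e ▸ Language.nil_mem_one)
      · ext w
        rw [zero_mul]
        exact ⟨fun hw => absurd ⟨w, hw⟩ hL, fun hw => absurd hw (Language.notMem_zero w)⟩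

variable {M}

theorem splits_nil {o : Option (Fin M.states)} :
    Splits P o [] ↔ (∃ q, o = some q ∧ P q = true) ∧ AllAcc P [] := by
  constructor
  · rintro ⟨u, v, e, h⟩
    obtain ⟨rfl, rfl⟩ := List.append_eq_nil_iff.1 e.symm
    exact h
  · exact fun h => ⟨[], [], rfl, h⟩

theorem splitsInner_nil {o : Option (Fin M.states)} : ¬ SplitsInner P o [] := by
  rintro ⟨u, v, e, hv, -⟩
  exact hv (List.append_eq_nil_iff.1 e.symm).2

theorem splitsStrictly_nil {o : Option (Fin M.states)} : ¬ SplitsStrictly P o [] := by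
  rintro ⟨u, v, e, hu, -⟩
  exact hu (List.append_eq_nil_iff.1 e.symm).1

theorem splits_cons {o : Option (Fin M.states)} {a : ℕ} {w : List ℕ} :
    Splits P o (a :: w) ↔ Splits P (M.total.step o a) w ∨
      (∃ q, o = some q ∧ P q = true) ∧ AllAcc P (a :: w) := by
  constructor
  · rintro ⟨_ | ⟨b, u⟩, v, e, h⟩
    · rw [List.nil_append] at e
      subst e
      exact .inr h
    · rw [List.cons_append, List.cons.injEq] at e
      obtain ⟨rfl, rfl⟩ := e
      exact .inl ⟨u, v, rfl, h⟩
  · rintro (⟨u, v, rfl, h⟩ | h)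
    · exact ⟨a :: u, v, rfl, h⟩
    · exact ⟨[], a :: w, rfl, h⟩

theorem splitsInner_cons {o : Option (Fin M.states)} {a : ℕ} {w : List ℕ} :
    SplitsInner P o (a :: w) ↔ SplitsInner P (M.total.step o a) w ∨
      (∃ q, o = some q ∧ P q = true) ∧ AllAcc P (a :: w) := by
  constructor
  · rintro ⟨_ | ⟨b, u⟩, v, e, hv, h⟩
    · rw [List.nil_append] at e
      subst e
      exact .inr h
    · rw [List.cons_append, List.cons.injEq] at e
      obtain ⟨rfl, rfl⟩ := e
      exact .inl ⟨u, v, rfl, hv, h⟩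
  · rintro (⟨u, v, rfl, hv, h⟩ | h)
    · exact ⟨a :: u, v, rfl, hv, h⟩
    · exact ⟨[], a :: w, rfl, List.cons_ne_nil _ _, h⟩

theorem splitsStrictly_cons {o : Option (Fin M.states)} {a : ℕ} {w : List ℕ} :
    SplitsStrictly P o (a :: w) ↔ SplitsInner P (M.total.step o a) w := by
  constructor
  · rintro ⟨_ | ⟨b, u⟩, v, e, hu, hv, h⟩
    · exact absurd rfl hu
    · rw [List.cons_append, List.cons.injEq] at e
      obtain ⟨rfl, rfl⟩ := e
      exact ⟨u, v, rfl, hv, h⟩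
  · rintro ⟨u, v, rfl, hv, h⟩
    exact ⟨a :: u, v, rfl, List.cons_ne_nil _ _, hv, h⟩

theorem not_splitsInto_none {u v : List ℕ} : ¬ SplitsInto P none u v := by
  rintro ⟨⟨q, hq, -⟩, -⟩
  rw [evalFrom_none] at hq
  simp at hq

theorem not_acc_none {w : List ℕ} : ¬ M.Acc none w := by
  rintro ⟨q, -, hq⟩
  rw [evalFrom_none] at hq
  simp at hq

end PartialDFA

namespace PrimalityTest

open PartialDFA

/-! ### What the program computes -/

section Spec

open Classical in
/-- What the marks are meant to say about the state `o` and the word `w`. -/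
noncomputable def specMark {M : PartialDFA} (P : Fin M.states → Bool) (w : List ℕ)
    (o : Option (Fin M.states)) : Mark :=
  ⟨decide (M.Acc o w), decide (Splits P o w), decide (SplitsInner P o w),
    decide (SplitsStrictly P o w)⟩

/-- The records of the states with given marks. -/
def recsOf {M : PartialDFA} (P : Fin M.states → Bool) (f : Fin M.states → Mark) : List Rec :=
  List.ofFn fun p => ⟨decide (p = M.start), decide (p ∈ M.accept), P p, f p⟩

/-- The numbers in the rows of the transition table. -/
def rowData (M : PartialDFA) (p : Fin M.states) : Bool × List ℕ :=
  (decide (p ∈ M.accept), List.ofFn fun a => (M.step p a).elim 0 fun q => (q : ℕ) + 1)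

variable {M : PartialDFA} (P : Fin M.states → Bool)

theorem specMark_none (w : List ℕ) : specMark P w none = default := by
  have h₁ : ¬ Splits P none w := fun ⟨_, _, _, h⟩ => not_splitsInto_none h
  have h₂ : ¬ SplitsInner P none w := fun ⟨_, _, _, _, h⟩ => not_splitsInto_none h
  have h₃ : ¬ SplitsStrictly P none w := fun ⟨_, _, _, _, _, h⟩ => not_splitsInto_none h
  simp only [specMark, h₁, h₂, h₃, not_acc_none, decide_false]
  rfl

theorem succMark_rowData (f : Fin M.states → Mark) (a : ℕ) (p : Fin M.states) :
    succMark (recsOf P f) a (rowData M p).2 =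
      (M.total.step (some p) a).elim default f := by
  by_cases ha : a < M.letters
  · rcases h : M.step p ⟨a, ha⟩ with _ | q <;>
      simp [succMark, rowData, ha, h, entryMark, total, recsOf]
  · simp [succMark, rowData, ha, total]

open Classical in
theorem allAcc_recsOf (f : Fin M.states → Mark) (w : List ℕ)
    (h : ∀ p, (f p).acc = decide (M.Acc (some p) w)) :
    allAcc (recsOf P f) = decide (AllAcc P w) := by
  rw [allAcc, recsOf, Bool.eq_iff_iff, decide_eq_true_iff]
  simp only [List.all_eq_true, List.mem_ofFn, forall_exists_index, forall_apply_eq_imp_iff, h,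
    decide_eq_true_eq, AllAcc, Bool.or_eq_true, Bool.not_eq_true']
  exact forall_congr' fun q => by cases P q <;> simp

theorem closeMarks_recsOf (b : Bool) (f : Fin M.states → Mark) :
    closeMarks b (recsOf P f) = recsOf P fun p =>
      { f p with split := (f p).split || (P p && allAcc (recsOf P f))
                 inner := (f p).inner || (P p && allAcc (recsOf P f) && b) } := by
  rw [closeMarks]
  conv_lhs => rw [recsOf]
  rw [List.map_ofFn, recsOf]
  rfl

theorem initRecs_recsOf (f : Fin M.states → Mark) :
    initRecs (recsOf P f) = recsOf P fun p => specMark P [] (some p) := by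
  classical
  have e : (recsOf P f).map (fun r => { r with mark := ⟨r.final, false, false, false⟩ }) =
      recsOf P fun p => ⟨decide (p ∈ M.accept), false, false, false⟩ := by
    rw [recsOf, List.map_ofFn]
    rfl
  have hacc : ∀ p, decide (p ∈ M.accept) = decide (M.Acc (some p) []) := fun p => by
    simp [PartialDFA.Acc, total]
  rw [initRecs, e, closeMarks_recsOf, allAcc_recsOf P _ [] hacc]
  congr 1
  funext p
  have h₁ : decide (Splits P (some p) []) = (P p && decide (AllAcc P [])) := Bool.eq_iff_iff.2 <| by
    simp [splits_nil]
  simp [specMark, hacc, h₁, splitsInner_nil, splitsStrictly_nil]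

theorem readLetter_recsOf (a : ℕ) (w : List ℕ) :
    readLetter ((List.ofFn (rowData M)).map Prod.snd) (recsOf P fun p => specMark P w (some p)) a =
      recsOf P fun p => specMark P (a :: w) (some p) := by
  classical
  let g : Fin M.states → Mark := fun p => specMark P w (M.total.step (some p) a)
  have hs : ∀ p, succMark (recsOf P fun p => specMark P w (some p)) a (rowData M p).2 = g p := by
    intro p
    rw [succMark_rowData]
    simp only [g]
    cases M.total.step (some p) a
    · exact (specMark_none P w).symm
    · rfl
  have e : List.zipWith enter (recsOf P fun p => specMark P w (some p))
      (((List.ofFn (rowData M)).map Prod.snd).map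
        (succMark (recsOf P fun p => specMark P w (some p)) a)) =
      recsOf P fun p => ⟨(g p).acc, (g p).split, (g p).inner, (g p).inner⟩ := by
    refine List.ext_getElem (by simp [recsOf]) fun i h₁ h₂ => ?_
    rw [List.getElem_zipWith, List.getElem_map, List.getElem_map, List.getElem_ofFn, hs]
    simp [recsOf, enter]
  have hacc : ∀ p, (g p).acc = decide (M.Acc (some p) (a :: w)) := fun p => rfl
  rw [readLetter, e, closeMarks_recsOf,
    allAcc_recsOf P (fun p => ⟨(g p).acc, (g p).split, (g p).inner, (g p).inner⟩) (a :: w) hacc]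
  congr 1
  funext p
  have h₁ : decide (Splits P (some p) (a :: w)) =
      (decide (Splits P (M.total.step (some p) a) w) || (P p && decide (AllAcc P (a :: w)))) :=
    Bool.eq_iff_iff.2 <| by simp [splits_cons]
  have h₂ : decide (SplitsInner P (some p) (a :: w)) =
      (decide (SplitsInner P (M.total.step (some p) a) w) ||
        (P p && decide (AllAcc P (a :: w)))) :=
    Bool.eq_iff_iff.2 <| by simp [splitsInner_cons]
  have h₃ : decide (SplitsStrictly P (some p) (a :: w)) =
      decide (SplitsInner P (M.total.step (some p) a) w) :=
    decide_eq_decide.2 splitsStrictly_cons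
  conv_rhs => rw [specMark, h₁, h₂, h₃]
  simp only [Bool.and_true]
  rfl

theorem startMark_eq {l : List Rec} {m x : Mark} (h : ∀ r ∈ l, r.start = true → r.mark = x)
    (h' : m = x ∨ ∃ r ∈ l, r.start = true) : startMark m l = x := by
  induction l generalizing m with
  | nil => simpa [startMark] using h'
  | cons r l ih =>
    rw [startMark, List.foldl_cons, ← startMark]
    refine ih (fun r hr => h r (List.mem_cons_of_mem _ hr)) ?_
    by_cases hr : r.start = true
    · left
      rw [if_pos hr]
      exact h r (by simp) hr
    · rw [if_neg hr]
      rcases h' with h' | ⟨r', hr', hs⟩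
      · exact .inl h'
      · rcases List.mem_cons.1 hr' with rfl | hr'
        · exact absurd hs hr
        · exact .inr ⟨r', hr', hs⟩

/-- The program processes the letters of a word from the last to the first. -/
theorem wordMark_recsOf (f : Fin M.states → Mark) (w : List ℕ) :
    wordMark ((List.ofFn (rowData M)).map Prod.snd) (recsOf P f) w.reverse =
      specMark P w (some M.start) := by
  have e : w.reverse.foldl (readLetter ((List.ofFn (rowData M)).map Prod.snd))
      (initRecs (recsOf P f)) = recsOf P fun p => specMark P w (some p) := by
    rw [List.foldl_reverse]
    induction w with
    | nil => exact initRecs_recsOf P f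
    | cons a w ih => rw [List.foldr_cons, ih, readLetter_recsOf]
  rw [wordMark, e]
  apply startMark_eq
  · intro r hr hs
    obtain ⟨p, rfl⟩ := List.mem_ofFn.1 hr
    rw [of_decide_eq_true hs]
  · exact .inr ⟨_, List.mem_ofFn.2 ⟨M.start, rfl⟩, by simp⟩

theorem getElem_selectRecs (vs : List Rec) (bs : List Bool) (i : ℕ) (h : i < vs.length) :
    (selectRecs vs bs)[i]'(by rwa [length_selectRecs]) =
      { vs[i] with final := vs[i].mark.acc, sel := bs.getD i false } := by
  induction vs generalizing bs i with
  | nil => simp at h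
  | cons r vs ih =>
    rcases i with _ | i
    · cases bs <;> simp [selectRecs]
    · simp only [selectRecs, List.getElem_cons_succ]
      rw [ih _ _ (by simpa using h)]
      cases bs <;> simp

theorem getElem_startRecs {n q i : ℕ} (hq : q < n) (h : i < n) :
    (startRecs n q)[i]'(by rwa [length_startRecs hq]) =
      { (default : Rec) with start := decide (i = q) } := by
  have hd : (default : Rec) = { (default : Rec) with start := false } := rfl
  simp only [startRecs, List.getElem_append, List.getElem_cons, List.getElem_replicate,
    List.length_replicate]
  split_ifs with h₁ h₂
  · simp only [show i ≠ q by omega, decide_false]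
    exact hd
  · simp only [show i = q by omega, decide_true]
  · simp only [show i ≠ q by omega, decide_false]
    exact hd

theorem tableRecs_eq (M : PartialDFA) (bs : List Bool) :
    ∃ f, tableRecs M.states M.start (List.ofFn (rowData M)) bs =
      recsOf (M := M) (fun p => bs.getD p false) f := by
  refine ⟨fun p => ⟨decide (p ∈ M.accept), false, false, false⟩, ?_⟩
  refine List.ext_getElem ?_ fun i h₁ h₂ => ?_
  · simp [tableRecs, length_selectRecs, length_startRecs M.start.2, recsOf]
  · have hi : i < M.states := by simpa [recsOf] using h₂
    simp only [tableRecs]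
    rw [getElem_selectRecs _ _ _ (by simpa [length_startRecs M.start.2] using hi),
      List.getElem_zipWith, getElem_startRecs M.start.2 hi]
    simp [recsOf, enter, rowData, Fin.ext_iff]

end Spec

/-! ### Membership in the second level of the polynomial hierarchy -/

theorem encode_eq_unary (M : PartialDFA) : M.encode =
    unary (M.states :: M.letters :: (M.start : ℕ) :: (List.ofFn (rowData M)).flatMap rowNumbers) := by
  have h : (List.ofFn M.row).flatten = (List.ofFn (rowData M)).flatMap rowNumbers := by
    rw [List.flatMap_def, List.map_ofFn]
    congr 2
    funext q
    simp [row, rowNumbers, rowData, Bool.toNat, Bool.cond_decide]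
  rw [← h]
  rfl

theorem describes_encode (M : PartialDFA) :
    Describes M.encode M.states M.letters M.start (List.ofFn (rowData M)) := by
  refine ⟨M.start.2, fun r hr => ?_, by simp, encode_eq_unary M⟩
  obtain ⟨p, rfl⟩ := List.mem_ofFn.1 hr
  refine ⟨by simp [rowData], fun t ht => ?_⟩
  obtain ⟨a, rfl⟩ := List.mem_ofFn.1 ht
  rcases M.step p a with _ | q
  · exact Nat.zero_le _
  · exact q.2

theorem exists_encode_of_describes {x : List Bool} {n k q : ℕ} {rows : List (Bool × List ℕ)}
    (h : Describes x n k q rows) : ∃ M : PartialDFA, M.encode = x := by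
  obtain ⟨hq, h₁, rfl, rfl⟩ := h
  have hlen : ∀ p : Fin rows.length, rows[p].2.length = k := fun p =>
    (h₁ _ (List.getElem_mem p.2)).1
  have hle : ∀ (p : Fin rows.length) (a : Fin k), rows[p].2[a]'(by rw [hlen]; exact a.2) ≤
      rows.length := fun p a => (h₁ _ (List.getElem_mem p.2)).2 _ (List.getElem_mem _)
  let M : PartialDFA :=
    { states := rows.length
      letters := k
      step := fun p a => if h : rows[p].2[a]'(by rw [hlen]; exact a.2) = 0 then none
        else some ⟨rows[p].2[a]'(by rw [hlen]; exact a.2) - 1, by have := hle p a; omega⟩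
      start := ⟨q, hq⟩
      accept := Finset.univ.filter fun p => rows[p].1 = true }
  refine ⟨M, ?_⟩
  have hrows : List.ofFn (rowData M) = rows := by
    refine List.ext_getElem (by simp [M]) fun i hi hi' => ?_
    rw [List.getElem_ofFn]
    refine Prod.ext ?_ ?_
    · simp [rowData, M]
    · refine List.ext_getElem ?_ fun j hj hj' => ?_
      · simpa [rowData, M] using (hlen ⟨i, hi'⟩).symm
      · simp only [rowData, List.getElem_ofFn, M]
        split_ifs with h
        · exact h.symm
        · simp only [Option.elim]
          exact Nat.sub_add_cancel (Nat.pos_of_ne_zero h)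
  rw [encode_eq_unary, hrows]

theorem readNumbers_unary (l : List ℕ) : readNumbers 0 (unary l) = l := by
  have key : ∀ m c (X : List Bool), readNumbers c (List.replicate m true ++ false :: X) =
      (c + m) :: readNumbers 0 X := by
    intro m
    induction m with
    | zero => intro c X; rfl
    | succ m ih =>
      intro c X
      rw [List.replicate_succ, List.cons_append, readNumbers, ih]
      congr 1
      omega
  induction l with
  | nil => rfl
  | cons m l ih =>
    have := unary_cons m l []
    rw [List.append_nil, List.append_nil] at this
    rw [this, key, ih, zero_add]

/-- The strings `y` and `z` are read as a set of states with a word, and as a word. -/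
theorem relation_encode (verdict : Mark → Bool → Mark → Bool → Bool) (bad : Bool) (M : PartialDFA)
    (y z : List Bool) (P : Fin M.states → Bool)
    (hP : ∀ p : Fin M.states, y.reverse.getD p false = P p)
    (w₀ w : List ℕ) (hw₀ : readNumbers 0 (y.reverse.drop M.states).reverse = w₀.reverse)
    (hw : readNumbers 0 z = w.reverse) :
    relation verdict bad (M.encode, y, z) =
      verdict (specMark P w₀ (some M.start)) (decide (M.states < w₀.length))
        (specMark P w (some M.start)) (decide (M.states < w.length)) := by
  obtain ⟨f, hf⟩ := tableRecs_eq M y.reverse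
  obtain rfl := funext hP
  rw [relation_of_describes (describes_encode M), hf, hw₀, hw, wordMark_recsOf, wordMark_recsOf,
    List.length_reverse, List.length_reverse]

/-- The code of a set of states together with a word. -/
def guess {n : ℕ} (P : Fin n → Bool) (w : List ℕ) : List Bool :=
  unary w.reverse ++ (List.ofFn P).reverse

theorem relation_guess (verdict : Mark → Bool → Mark → Bool → Bool) (bad : Bool) (M : PartialDFA)
    (P : Fin M.states → Bool) (w₀ : List ℕ) (z : List Bool) :
    ∃ w, relation verdict bad (M.encode, guess P w₀, z) =
      verdict (specMark P w₀ (some M.start)) (decide (M.states < w₀.length))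
        (specMark P w (some M.start)) (decide (M.states < w.length)) := by
  have e : (guess P w₀).reverse = List.ofFn P ++ (unary w₀.reverse).reverse := by simp [guess]
  refine ⟨(readNumbers 0 z).reverse, relation_encode verdict bad M _ z P (fun p => ?_) w₀ _ ?_ ?_⟩
  · rw [e]
    simp [List.getD, List.getElem?_append_left]
  · rw [e, List.drop_append_of_le_length (by simp), List.drop_of_length_le (by simp),
      List.nil_append, List.reverse_reverse, readNumbers_unary]
  · rw [List.reverse_reverse]

theorem exists_relation_unary (verdict : Mark → Bool → Mark → Bool → Bool) (bad : Bool)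
    (M : PartialDFA) (y : List Bool) : ∃ (P : Fin M.states → Bool) (w₀ : List ℕ), ∀ w : List ℕ,
    relation verdict bad (M.encode, y, unary w.reverse) =
      verdict (specMark P w₀ (some M.start)) (decide (M.states < w₀.length))
        (specMark P w (some M.start)) (decide (M.states < w.length)) :=
  ⟨fun p => y.reverse.getD p false, (readNumbers 0 (y.reverse.drop M.states).reverse).reverse,
    fun _ => relation_encode verdict bad M y _ _ (fun _ => rfl) _ _
      (List.reverse_reverse _).symm (readNumbers_unary _)⟩

/-- A bound for the length of the code of a set of states together with a word that has at most
`2 * n + 1` letters, where `n` is the number of states. -/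
noncomputable def bound : Polynomial ℕ :=
  .X * (2 * .X + 1) + .X

theorem length_unary (l : List ℕ) : (unary l).length = l.sum + l.length := by
  induction l with
  | nil => rfl
  | cons m l ih =>
    rw [unary, List.flatMap_cons, List.length_append, ← unary, ih]
    simp
    omega

theorem length_unary_le {M : PartialDFA} {w : List ℕ} (hw : M.Acc (some M.start) w)
    (hl : w.length ≤ 2 * M.states + 1) :
    M.states + (unary w.reverse).length ≤ bound.eval M.encode.length := by
  obtain ⟨u, rfl⟩ := hw.exists_map_val
  have hx : M.states + M.letters ≤ M.encode.length := by
    rw [encode_eq_unary, length_unary]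
    simp only [List.sum_cons]
    omega
  have hu : (u.map Fin.val).sum + u.length ≤ M.letters * u.length := by
    clear hl hw
    induction u with
    | nil => simp
    | cons a u ih =>
      simp only [List.map_cons, List.sum_cons, List.length_cons, Nat.mul_succ]
      have := a.2
      omega
  rw [length_unary, List.sum_reverse, List.length_reverse, List.length_map]
  rw [List.length_map] at hl
  have h₁ : M.letters * u.length ≤ M.encode.length * (2 * M.encode.length + 1) :=
    Nat.mul_le_mul (by omega) (by omega)
  simp only [bound, Polynomial.eval_add, Polynomial.eval_mul, Polynomial.eval_X,
    Polynomial.eval_ofNat, Polynomial.eval_one]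
  omega

theorem length_guess {n : ℕ} (P : Fin n → Bool) (w : List ℕ) :
    (guess P w).length = n + (unary w.reverse).length := by
  simp [guess, Nat.add_comm]

/-- A bound for the length of an accepted word, if the language is finite. -/
theorem length_le_of_finite {M : PartialDFA}
    (h : Set.Finite (M.language : Set (List (Fin M.letters)))) {w : List ℕ}
    (hw : M.Acc (some M.start) w) : w.length ≤ M.states :=
  not_lt.1 fun hl => infinite_of_acc hw hl h

/-- A decomposition can be guessed by a short string. -/
theorem exists_short_guess {M : PartialDFA}
    (h : Set.Finite (M.language : Set (List (Fin M.letters)))) (hM : M.language.IsDecomposable) :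
    ∃ (P : Fin M.states → Bool) (w₀ : List ℕ), (∀ w, M.Acc (some M.start) w →
      Splits P (some M.start) w ∧ SplitsStrictly P (some M.start) w₀) ∧
      (guess P w₀).length ≤ bound.eval M.encode.length := by
  obtain ⟨P, w₀, hP⟩ := (isDecomposable_iff M).1 hM
  by_cases hL : ∃ w, M.Acc (some M.start) w
  · obtain ⟨w, hw⟩ := hL
    have hw₀ := (hP w hw).2.acc
    refine ⟨P, w₀, hP, ?_⟩
    rw [length_guess]
    exact length_unary_le hw₀ (by have := length_le_of_finite h hw₀; omega)
  · -- The language is empty, so that the word does not matter.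
    refine ⟨P, [], fun w hw => absurd ⟨w, hw⟩ hL, ?_⟩
    have hx : M.states ≤ M.encode.length := by
      rw [encode_eq_unary, length_unary]
      simp only [List.sum_cons]
      omega
    rw [length_guess]
    simp only [bound, Polynomial.eval_add, Polynomial.eval_mul, Polynomial.eval_X,
      Polynomial.eval_ofNat, Polynomial.eval_one]
    exact le_add_left (by simpa [unary] using hx)

theorem exists_encode_of_relation {verdict : Mark → Bool → Mark → Bool → Bool} {bad : Bool}
    {x y z : List Bool} (h : relation verdict bad (x, y, z) ≠ bad) :
    ∃ M : PartialDFA, M.encode = x := by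
  by_contra hx
  exact h (relation_of_not_describes (fun _ _ _ _ hd => hx (exists_encode_of_describes hd)) y z)

/-- The verdict for the decomposability of finite languages: if the second word is accepted, then
it is not too long and splits, and the first word splits into two nonempty parts. -/
def decomposableVerdict (m₀ : Mark) (_ : Bool) (m : Mark) (long : Bool) : Bool :=
  !m.acc || (!long && m.split && m₀.strict)

/-- The verdict for the failure of finiteness or primality: the first word is accepted and too long,
or if the second word is accepted, then it splits, and the first word splits into two nonempty
parts. -/
def nonprimeVerdict (m₀ : Mark) (long₀ : Bool) (m : Mark) (_ : Bool) : Bool :=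
  (m₀.acc && long₀) || !m.acc || (m.split && m₀.strict)

theorem decomposableVerdict_spec {M : PartialDFA} (P : Fin M.states → Bool) (w₀ w : List ℕ)
    (o : Option (Fin M.states)) (b : Bool) (n : ℕ) :
    decomposableVerdict (specMark P w₀ o) b (specMark P w o) (decide (n < w.length)) = true ↔
      (M.Acc o w → w.length ≤ n ∧ Splits P o w ∧ SplitsStrictly P o w₀) := by
  simp [decomposableVerdict, specMark, imp_iff_not_or, and_assoc]

theorem nonprimeVerdict_spec {M : PartialDFA} (P : Fin M.states → Bool) (w₀ w : List ℕ)
    (o : Option (Fin M.states)) (b : Bool) (n : ℕ) :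
    nonprimeVerdict (specMark P w₀ o) (decide (n < w₀.length)) (specMark P w o) b = true ↔
      (M.Acc o w₀ ∧ n < w₀.length) ∨ (M.Acc o w → Splits P o w ∧ SplitsStrictly P o w₀) := by
  simp [nonprimeVerdict, specMark, imp_iff_not_or, or_assoc]

theorem inSigma2P_nonPrimalityFinite : InSigma2P NonPrimalityFinite := by
  refine ⟨bound, relation decomposableVerdict false, polyTimeDecidable_relation _ _, fun x => ?_⟩
  constructor
  · rintro ⟨M, rfl, hfin, hM⟩
    obtain ⟨P, w₀, hP, hlen⟩ := exists_short_guess hfin (not_not.1 hM)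
    refine ⟨guess P w₀, hlen, fun z _ => ?_⟩
    obtain ⟨w, e⟩ := relation_guess decomposableVerdict false M P w₀ z
    rw [e, decomposableVerdict_spec]
    exact fun hw => ⟨length_le_of_finite hfin hw, hP w hw⟩
  · rintro ⟨y, -, h⟩
    obtain ⟨M, rfl⟩ := exists_encode_of_relation (x := x) (y := y) (z := [])
      (by rw [h [] (Nat.zero_le _)]; exact Bool.noConfusion)
    obtain ⟨P, w₀, e⟩ := exists_relation_unary decomposableVerdict false M y
    have key : ∀ w, M.Acc (some M.start) w → w.length ≤ 2 * M.states + 1 →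
        w.length ≤ M.states ∧ Splits P (some M.start) w ∧ SplitsStrictly P (some M.start) w₀ := by
      intro w hw hl
      have := h (unary w.reverse) (le_of_add_le_right (length_unary_le hw hl))
      rw [e, decomposableVerdict_spec] at this
      exact this hw
    have hfin : Set.Finite (M.language : Set (List (Fin M.letters))) := by
      by_contra hinf
      obtain ⟨w, hw, hl, hl'⟩ := exists_acc_of_infinite hinf
      exact absurd (key w hw hl').1 (not_le.2 hl)
    refine ⟨M, rfl, hfin, not_not.2 ((isDecomposable_iff M).2 ⟨P, w₀, fun w hw => ?_⟩)⟩
    exact (key w hw (by have := length_le_of_finite hfin hw; omega)).2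

theorem inPi2P_primalityFinite : InPi2P PrimalityFinite := by
  refine ⟨bound, relation nonprimeVerdict true, polyTimeDecidable_relation _ _, fun x => ?_⟩
  by_cases hx : ∃ M : PartialDFA, M.encode = x
  swap
  · refine ⟨fun _ => ⟨[], Nat.zero_le _, fun z _ => ?_⟩, fun _ => ?_⟩
    · by_contra hz
      exact hx (exists_encode_of_relation hz)
    · rintro ⟨M, hM, -⟩
      exact hx ⟨M, hM⟩
  obtain ⟨M, rfl⟩ := hx
  have hmem : M.encode ∈ PrimalityFiniteᶜ ↔
      ¬ Set.Finite (M.language : Set (List (Fin M.letters))) ∨ M.language.IsDecomposable := by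
    have : M.encode ∈ PrimalityFinite ↔
        Set.Finite (M.language : Set (List (Fin M.letters))) ∧ M.language.IsPrimeLanguage := by
      constructor
      · rintro ⟨M', hM', h⟩
        obtain rfl := encode_injective hM'
        exact h
      · exact fun h => ⟨M, rfl, h⟩
    change ¬ (M.encode ∈ PrimalityFinite) ↔ _
    rw [this, Language.IsPrimeLanguage, not_and_or, not_not]
  rw [hmem]
  constructor
  · intro h
    by_cases hfin : Set.Finite (M.language : Set (List (Fin M.letters)))
    · obtain ⟨P, w₀, hP, hlen⟩ := exists_short_guess hfin (h.resolve_left (not_not.2 hfin))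
      refine ⟨guess P w₀, hlen, fun z _ => ?_⟩
      obtain ⟨w, e⟩ := relation_guess nonprimeVerdict true M P w₀ z
      rw [e, nonprimeVerdict_spec]
      exact .inr (hP w)
    · obtain ⟨w₀, hw₀, hl, hl'⟩ := exists_acc_of_infinite hfin
      refine ⟨guess (fun _ : Fin M.states => false) w₀, ?_, fun z _ => ?_⟩
      · rw [length_guess]
        exact length_unary_le hw₀ hl'
      obtain ⟨w, e⟩ := relation_guess nonprimeVerdict true M (fun _ => false) w₀ z
      rw [e, nonprimeVerdict_spec]
      exact .inl ⟨hw₀, hl⟩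
  · rintro ⟨y, -, h⟩
    obtain ⟨P, w₀, e⟩ := exists_relation_unary nonprimeVerdict true M y
    rw [or_iff_not_imp_left, not_not]
    intro hfin
    refine (isDecomposable_iff M).2 ⟨P, w₀, fun w hw => ?_⟩
    have hl := length_le_of_finite hfin hw
    have := h (unary w.reverse) (le_of_add_le_right (length_unary_le hw (by omega)))
    rw [e, nonprimeVerdict_spec] at this
    exact this.resolve_left (fun h₀ => infinite_of_acc h₀.1 h₀.2 hfin) hw

end PrimalityTest

theorem mainTheorem2 : InPi2P PrimalityFinite ∧ InSigma2P NonPrimalityFinite :=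
  ⟨PrimalityTest.inPi2P_primalityFinite, PrimalityTest.inSigma2P_nonPrimalityFinite⟩
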